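/- **Setting.** Let $(\mathcal S,\mathcal A,\mathcal B,r,P)$ be a two-player zero-sum simultaneous-move stochastic game with finite nonempty sets of states and actions, of sizes $S,A,B$, rewards $r(s,a,b)\in[0,1]$ (gained by the max-player, the learner) and transition probabilities $P(\cdot\mid s,a,b)$. Markovian policies are maps $\mu:\mathcal S\to\Delta_{\mathcal A}$ and $\nu:\mathcal S\to\Delta_{\mathcal B}$; under $(\mu,\nu)$ the states form a Markov chain with kernel $P^{(\mu,\nu)}(s'\mid s)=\mathbb E_{a\sim\mu(\cdot|s),b\sim\nu(\cdot|s)}[P(s'\mid s,a,b)]$, and $r^{(\mu,\nu)}(s)=\mathbb E_{a\sim\mu(\cdot|s),b\sim\nu(\cdot|s)}[r(s,a,b)]$. Let $J^{(\mu,\nu)}(s)=\lim_{n\to\infty}\frac1n\mathbb E_{(\mu,\nu)}\big[\sum_{t=1}^n r^{(\mu,\nu)}(s_t)\mid s_1=s\big]$. *Assumption 1:* for all states $s,s'$ and every Markovian policy $\nu$ of the min-player there is a Markovian policy $\mu$ of the max-player under which $s'$ is accessible from $s$ with positive probability. Let $D\in[0,\infty)$ be an upper bound of the diameter $\sup_{s,s'}\sup_\nu\inf_\mu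 T^{(\mu,\nu)}_{s\to s'}$, where $T^{(\mu,\nu)}_{s\to s'}$ is the expected hitting time of $s'$ from $s$ ($0$ if $s=s'$). **DONQ-learning** with parameters $H>1$, $\delta\in(0,1)$, horizon $T$ and the known bound $D$: put $\gamma=1-1/H$, $\alpha_\tau=\frac{H+1}{H+\tau}$, $\beta_\tau=2D\sqrt{H\log(2T/\delta)/\tau}$. Start with $\overline Q_1=\overline Q^{\downarrow}_1=\overline V^{\downarrow}_1=H$, $N_1=0$, $\mu_1(a\mid s)=1/A$. At each time $t=1,\dots,T$, in state $s_t$, the learner draws $a_t\sim\mu_t(\cdot\mid s_t)$, observes $b_t$, $r(s_t,a_t,b_t)$, $s_{t+1}$, sets $\tau=N_{t+1}(s_t,a_t,b_t)=N_t(s_t,a_t,b_t)+1$ and $$\overline Q_{t+1}(s_t,a_t,b_t)=(1-\alpha_\tau)\overline Q_t(s_t,a_t,b_t)+\alpha_\tau\big[r(s_t,a_t,b_t)+\gamma\overline V^{\downarrow}_t(s_{t+1})+\beta_\tau\big],$$ $$\overline Q^{\downarrow}_{t+1}(s_t,a_t,b_t)=\min\big(\overline Q^{\downarrow}_t(s_t,a_t,b_t),\overline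 Q_{t+1}(s_t,a_t,b_t)\big),$$ lets $(\mu_{t+1}(\cdot\mid s_t),\tilde\nu_{t+1}(\cdot\mid s_t))$ be a Nash equilibrium (returned by a fixed procedure) of the matrix game $\overline Q^{\downarrow}_{t+1}(s_t,\cdot,\cdot)$, and sets $\overline V^{\downarrow}_{t+1}(s_t)$ to the expected payoff of this equilibrium. All other entries are unchanged. The opponent is arbitrary: at each time $t$ it plays $b_t\sim\nu_t$, where $\nu_t$ may depend in any way on the history up to $s_t$ and on private information; given all of this, $a_t$ and $b_t$ are independent, and $s_{t+1}\sim P(\cdot\mid s_t,a_t,b_t)$. **Theorem 1.** There is an absolute constant $C$ such that, for every such game satisfying Assumption 1 and every $D$ as above, the following holds. The game has a value $J^*=\sup_\mu\inf_\nu J^{(\mu,\nu)}(s)=\inf_\nu\sup_\mu J^{(\mu,\nu)}(s)$ that does not depend on $s$; and for all $H>1$, $\delta\in(0,1)$ and $T$, and every opponent, the regret $\mathrm{Reg}(T)=\sum_{t=1}^T\big(J^*-r(s_t,a_t,b_t)\big)$ of DONQ-learning satisfies, with probability at least $1-3\delta$, $$\mathrm{Reg}(T)\le D\frac TH+2H\sqrt{2T\log(2/\delta)}+12D\sqrt{SABHT\log(2T/\delta)}+C\Big(SABH+D\sqrt{T\log(4/\delta)}\Big).$$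 -/

import Mathlib

open MeasureTheory Filter Topology
open scoped ENNReal NNReal

/-- A finite two-player zero-sum simultaneous-move stochastic game with states `S`, actions `A` of
the max-player and `B` of the min-player: rewards in `[0, 1]`, and a transition distribution
`P s a b` on the states. -/
structure StochasticGame (S A B : Type*) [Fintype S] where
  r : S → A → B → ℝ
  P : S → A → B → stdSimplex ℝ S
  r_mem : ∀ s a b, r s a b ∈ Set.Icc (0 : ℝ) 1

/-- A (stationary, randomized) Markovian policy: a distribution on actions for every state. -/
abbrev MarkovPolicy (S A : Type*) [Fintype A] := S → stdSimplex ℝ A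

/-- The expected payoff `𝔼_{a ∼ p, b ∼ q} [M a b]` of the mixed actions `p`, `q` in the matrix
game `M`. -/
def mixedPayoff {A B : Type*} [Fintype A] [Fintype B]
    (M : A → B → ℝ) (p : stdSimplex ℝ A) (q : stdSimplex ℝ B) : ℝ :=
  ∑ a, ∑ b, p a * q b * M a b

/-- `(p, q)` is a Nash equilibrium of the zero-sum matrix game `M` (row player maximizes, column
player minimizes). -/
def IsMatrixNash {A B : Type*} [Fintype A] [Fintype B]
    (M : A → B → ℝ) (p : stdSimplex ℝ A) (q : stdSimplex ℝ B) : Prop :=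
  (∀ p', mixedPayoff M p' q ≤ mixedPayoff M p q) ∧
    ∀ q', mixedPayoff M p q ≤ mixedPayoff M p q'

/-- A procedure that returns, for every matrix game, some Nash equilibrium of it. -/
def IsNashSolver {A B : Type*} [Fintype A] [Fintype B]
    (nash : (A → B → ℝ) → stdSimplex ℝ A × stdSimplex ℝ B) : Prop :=
  ∀ M, IsMatrixNash M (nash M).1 (nash M).2

namespace StochasticGame

section Game

variable {S A B : Type*} [Fintype S] [Fintype A] [Fintype B] (G : StochasticGame S A B)

/-- The expected one-step reward `r^{(μ,ν)}(s)`. -/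
def rewardOf (μ : MarkovPolicy S A) (ν : MarkovPolicy S B) (s : S) : ℝ :=
  mixedPayoff (G.r s) (μ s) (ν s)

/-- The transition matrix `P^{(μ,ν)}(s' | s)` of the Markov chain of states under `(μ, ν)`. -/
def kernelOf (μ : MarkovPolicy S A) (ν : MarkovPolicy S B) : Matrix S S ℝ :=
  fun s s' => mixedPayoff (fun a b => G.P s a b s') (μ s) (ν s)

variable [DecidableEq S]

/-- Every state is accessible from every state: against every Markovian policy of the min-player,
the max-player has a Markovian policy under which `s'` is reached from `s` with positive
probability. -/
def Communicating : Prop :=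
  ∀ (s s' : S) (ν : MarkovPolicy S B), ∃ μ : MarkovPolicy S A,
    ∃ n : ℕ, 0 < (G.kernelOf μ ν ^ n) s s'

/-- The probability that the Markov chain with kernel `P^{(μ,ν)}` started at `s` has not visited
`s'` at any of the times `0, …, n`. -/
def avoidProb (μ : MarkovPolicy S A) (ν : MarkovPolicy S B) (s' : S) : ℕ → S → ℝ
  | 0, s => if s = s' then 0 else 1
  | n + 1, s => if s = s' then 0 else ∑ x, G.kernelOf μ ν s x * avoidProb μ ν s' n x

/-- The expected time `T^{(μ,ν)}_{s → s'}` to go from `s` to `s'`, in `[0, ∞]`: the hitting time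
`τ ≥ 0` of `s'` has `𝔼 τ = ∑ₙ ℙ(τ > n)`. -/
noncomputable def expHittingTime (μ : MarkovPolicy S A) (ν : MarkovPolicy S B) (s s' : S) : ℝ≥0∞ :=
  ∑' n : ℕ, ENNReal.ofReal (G.avoidProb μ ν s' n s)

/-- The diameter of the game. -/
noncomputable def diameter : ℝ≥0∞ :=
  ⨆ (s : S) (s' : S) (ν : MarkovPolicy S B), ⨅ μ : MarkovPolicy S A, G.expHittingTime μ ν s s'

/-- The average reward `J^{(μ,ν)}(s)`: the limit of
`(1/n) 𝔼_{(μ,ν)} [∑_{t=1}^n r^{(μ,ν)}(s_t) | s_1 = s]`. -/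
noncomputable def avgReward (μ : MarkovPolicy S A) (ν : MarkovPolicy S B) (s : S) : ℝ :=
  limUnder atTop fun n : ℕ =>
    (∑ t ∈ Finset.range n, ∑ x, (G.kernelOf μ ν ^ t) s x * G.rewardOf μ ν x) / n

/-- `J` is the value of the average-reward game, from every initial state. -/
def IsGameValue (J : ℝ) : Prop :=
  ∀ s : S,
    (⨆ μ : MarkovPolicy S A, ⨅ ν : MarkovPolicy S B, G.avgReward μ ν s) = J ∧
    (⨅ ν : MarkovPolicy S B, ⨆ μ : MarkovPolicy S A, G.avgReward μ ν s) = J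

end Game

end StochasticGame

/-- The variables of DONQ-learning: visit counts `N`, the estimators `Q`, `Qdown`, `Vdown`, and the
current policy `pol` of the learner. -/
structure DONQState (S A B : Type*) [Fintype A] where
  N : S → A → B → ℕ
  Q : S → A → B → ℝ
  Qdown : S → A → B → ℝ
  Vdown : S → ℝ
  pol : MarkovPolicy S A

namespace DONQ

/-- The learning rate `α_τ = (H + 1) / (H + τ)`. -/
noncomputable def alpha (H : ℝ) (τ : ℕ) : ℝ := (H + 1) / (H + τ)

/-- The bonus `β_τ = 2 D √(H log(2T/δ) / τ)`. -/
noncomputable def beta (D H δ : ℝ) (T τ : ℕ) : ℝ :=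
  2 * D * Real.sqrt (H * Real.log (2 * T / δ) / τ)

section Algorithm

variable {S A B : Type*} [Fintype A] [Fintype B]

/-- Initialization. -/
noncomputable def init (S A B : Type*) [Fintype A] [Nonempty A] (H : ℝ) : DONQState S A B where
  N := fun _ _ _ => 0
  Q := fun _ _ _ => H
  Qdown := fun _ _ _ => H
  Vdown := fun _ => H
  pol := fun _ => stdSimplex.barycenter

variable [DecidableEq S] [DecidableEq A] [DecidableEq B]

/-- One iteration, after observing state `s`, actions `a`, `b`, reward `rew` and next state `s'`.
Only the entries at `(s, a, b)`, respectively at `s`, are modified. -/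
noncomputable def step (nash : (A → B → ℝ) → stdSimplex ℝ A × stdSimplex ℝ B)
    (D H δ : ℝ) (T : ℕ) (x : DONQState S A B) (s : S) (a : A) (b : B) (rew : ℝ) (s' : S) :
    DONQState S A B :=
  let τ : ℕ := x.N s a b + 1
  let γ : ℝ := 1 - 1 / H
  let q : ℝ := (1 - alpha H τ) * x.Q s a b
    + alpha H τ * (rew + γ * x.Vdown s' + beta D H δ T τ)
  let Qdown' : S → A → B → ℝ := fun u v w =>
    if u = s ∧ v = a ∧ w = b then min (x.Qdown s a b) q else x.Qdown u v w
  let eq := nash (Qdown' s)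
  { N := fun u v w => if u = s ∧ v = a ∧ w = b then τ else x.N u v w
    Q := fun u v w => if u = s ∧ v = a ∧ w = b then q else x.Q u v w
    Qdown := Qdown'
    Vdown := fun u => if u = s then mixedPayoff (Qdown' s) eq.1 eq.2 else x.Vdown u
    pol := fun u => if u = s then eq.1 else x.pol u }

variable [Fintype S] [Nonempty A]

/-- The variables of the algorithm after `t` iterations along the trajectory `s`, `a`, `b`. Times
are numbered from `0`, so that the `(t+1)`-st iteration starts in the state `s t` with actions
`a t`, `b t`, and observes the next state `s (t + 1)`. -/
noncomputable def state (G : StochasticGame S A B)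
    (nash : (A → B → ℝ) → stdSimplex ℝ A × stdSimplex ℝ B)
    (D H δ : ℝ) (T : ℕ) (s : ℕ → S) (a : ℕ → A) (b : ℕ → B) : ℕ → DONQState S A B
  | 0 => init S A B H
  | t + 1 => step nash D H δ T (state G nash D H δ T s a b t) (s t) (a t) (b t)
      (G.r (s t) (a t) (b t)) (s (t + 1))

/-- The processes `s`, `a`, `b` are a play of the game `G` of length `T` in which the max-player
runs DONQ-learning and the min-player is arbitrary. The σ-algebra `ℱ t` is the information
available before the actions of time `t`: it contains the history up to the state `s t`, and
possibly more, such as private randomness and memory of the opponent. The opponent plays any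
mixed action `ν t` that depends on `ℱ t`. Given `ℱ t`, the actions `a t` and `b t` are drawn
independently from the learner's current policy at `s t` and from `ν t`, and then `s (t + 1)` is
drawn from the transition distribution. -/
structure IsPlay (G : StochasticGame S A B)
    (nash : (A → B → ℝ) → stdSimplex ℝ A × stdSimplex ℝ B)
    (D H δ : ℝ) (T : ℕ) {Ω : Type*} {m : MeasurableSpace Ω} (ℙ : Measure Ω)
    (ℱ : Filtration ℕ m) (s : ℕ → Ω → S) (a : ℕ → Ω → A) (b : ℕ → Ω → B)
    (ν : ℕ → Ω → stdSimplex ℝ B) : Prop where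
  measurable_s : ∀ t ≤ T, ∀ x, MeasurableSet[ℱ t] {ω | s t ω = x}
  measurable_a : ∀ t < T, ∀ x, MeasurableSet[ℱ (t + 1)] {ω | a t ω = x}
  measurable_b : ∀ t < T, ∀ x, MeasurableSet[ℱ (t + 1)] {ω | b t ω = x}
  measurable_ν : ∀ t < T, ∀ y, Measurable[ℱ t] fun ω => ν t ω y
  condLaw : ∀ t < T, ∀ (x : A) (y : B) (z : S),
    condExp (ℱ t) ℙ
        (Set.indicator {ω | a t ω = x ∧ b t ω = y ∧ s (t + 1) ω = z} fun _ => (1 : ℝ))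
      =ᵐ[ℙ] fun ω =>
        (state G nash D H δ T (fun i => s i ω) (fun i => a i ω) (fun i => b i ω) t).pol (s t ω) x
          * ν t ω y * G.P (s t ω) x y z

end Algorithm

end DONQ

/-- The regret `Reg(T) = ∑_{t=1}^T (J - r(s_t, a_t, b_t))` of a trajectory (times numbered
from `0`). -/
noncomputable def regret {S A B : Type*} [Fintype S] (G : StochasticGame S A B) (J : ℝ) (T : ℕ)
    (s : ℕ → S) (a : ℕ → A) (b : ℕ → B) : ℝ :=
  ∑ t ∈ Finset.range T, (J - G.r (s t) (a t) (b t))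

/-! ### Matrix games -/

section MatrixGame

variable {A B : Type*} [Fintype A] [Fintype B]

/-! Everything is compared with the solution `V` of the Shapley equations with discount factor `1 -
1 / H`, a fixed function on the states. Its span is at most `D`, whatever `H` is
(`IsDiscountedValue.sub_le_diameter`): when the min-player follows its optimal discounted policy and
the max-player heads for `s'`, the gap `V s' - V` shrinks by at most one per step in expectation, so
it is at most the expected hitting time. Used as a certificate for the undiscounted chain, `V` then
places both average-reward values within `D / H` of `V / H`. Letting `H → ∞` proves that the value
exists, and the given `H` costs `D * T / H` in the regret (`exists_isGameValue`).

Along a trajectory, `Q` is a running average of its targets, so its error against the lookahead of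
`V` is an average of earlier errors of `Vdown`, of the noise in `V` at the next state, and of
bonuses (`state_Q_sub_lookahead`). The noise involves the fixed `V`, of span `D`, and not the
estimate `Vdown`, of range `H`; hence bonuses proportional to `D` dominate it. On that event
induction gives `V ≤ Vdown` (`optimism`). In the regret the errors of `Vdown` then cancel, because a
sample receives total weight at most `1 + 1 / H` and `(1 - 1 / H) * (1 + 1 / H) ≤ 1`; the changes of
the decreasing estimates telescope (`regret_le_of_noiseBounded`).

What remains is a sum of noise, and the sum of `Vdown - Qdown` at the realized actions. The latter
has nonpositive conditional mean for every action of the opponent, since the policy is an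
equilibrium strategy of the matrix `Qdown`. All three random quantities are controlled by one
exponential supermartingale (`integral_exp_sum_le_one`), whose hypothesis is imposed for each
opponent action separately, so that the opponent may be arbitrary. -/

lemma mixedPayoff_mono {M M' : A → B → ℝ} (h : ∀ a b, M a b ≤ M' a b)
    (p : stdSimplex ℝ A) (q : stdSimplex ℝ B) : mixedPayoff M p q ≤ mixedPayoff M' p q :=
  Finset.sum_le_sum fun a _ => Finset.sum_le_sum fun b _ =>
    mul_le_mul_of_nonneg_left (h a b) (mul_nonneg (stdSimplex.zero_le p a) (stdSimplex.zero_le q b))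

lemma mixedPayoff_eq_sum_left (M : A → B → ℝ) (p : stdSimplex ℝ A) (q : stdSimplex ℝ B) :
    mixedPayoff M p q = ∑ a, p a * ∑ b, q b * M a b := by
  simp only [mixedPayoff, Finset.mul_sum, mul_assoc]

lemma mixedPayoff_eq_sum_right (M : A → B → ℝ) (p : stdSimplex ℝ A) (q : stdSimplex ℝ B) :
    mixedPayoff M p q = ∑ b, q b * ∑ a, p a * M a b := by
  rw [mixedPayoff, Finset.sum_comm]
  simp only [Finset.mul_sum]
  exact Finset.sum_congr rfl fun b _ => Finset.sum_congr rfl fun a _ => by ring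

@[simp]
lemma mixedPayoff_const (c : ℝ) (p : stdSimplex ℝ A) (q : stdSimplex ℝ B) :
    mixedPayoff (fun _ _ => c) p q = c := by
  simp [mixedPayoff_eq_sum_left, ← Finset.sum_mul]

lemma mixedPayoff_add (M M' : A → B → ℝ) (p : stdSimplex ℝ A) (q : stdSimplex ℝ B) :
    mixedPayoff (fun a b => M a b + M' a b) p q = mixedPayoff M p q + mixedPayoff M' p q := by
  simp only [mixedPayoff, mul_add, Finset.sum_add_distrib]

lemma mixedPayoff_const_mul (c : ℝ) (M : A → B → ℝ) (p : stdSimplex ℝ A) (q : stdSimplex ℝ B) :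
    mixedPayoff (fun a b => c * M a b) p q = c * mixedPayoff M p q := by
  simp only [mixedPayoff, Finset.mul_sum]
  exact Finset.sum_congr rfl fun a _ => Finset.sum_congr rfl fun b _ => by ring

lemma mixedPayoff_sum {ι : Type*} (t : Finset ι) (M : ι → A → B → ℝ)
    (p : stdSimplex ℝ A) (q : stdSimplex ℝ B) :
    mixedPayoff (fun a b => ∑ i ∈ t, M i a b) p q = ∑ i ∈ t, mixedPayoff (M i) p q := by
  simp only [mixedPayoff, Finset.mul_sum]
  exact (Finset.sum_congr rfl fun a _ => Finset.sum_comm).trans Finset.sum_comm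

lemma mixedPayoff_vertex_right [DecidableEq B] (M : A → B → ℝ) (p : stdSimplex ℝ A) (b : B) :
    mixedPayoff M p (stdSimplex.vertex b) = ∑ a, p a * M a b := by
  rw [mixedPayoff_eq_sum_right]
  simp [Pi.single_apply]

lemma stdSimplex.sum_mul_le {ι : Type*} [Fintype ι] (p : stdSimplex ℝ ι) {f : ι → ℝ} {c : ℝ}
    (h : ∀ i, f i ≤ c) : ∑ i, p i * f i ≤ c :=
  calc ∑ i, p i * f i ≤ ∑ i, p i * c :=
        Finset.sum_le_sum fun i _ => mul_le_mul_of_nonneg_left (h i) (stdSimplex.zero_le p i)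
    _ = c := by rw [← Finset.sum_mul, stdSimplex.sum_eq_one, one_mul]

lemma stdSimplex.le_sum_mul {ι : Type*} [Fintype ι] (p : stdSimplex ℝ ι) {f : ι → ℝ} {c : ℝ}
    (h : ∀ i, c ≤ f i) : c ≤ ∑ i, p i * f i :=
  calc c = ∑ i, p i * c := by rw [← Finset.sum_mul, stdSimplex.sum_eq_one, one_mul]
    _ ≤ ∑ i, p i * f i :=
        Finset.sum_le_sum fun i _ => mul_le_mul_of_nonneg_left (h i) (stdSimplex.zero_le p i)

/-- The theorem of the alternative behind the minimax theorem. -/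
lemma exists_mixed_of_forall_exists_le [Nonempty B] (M : A → B → ℝ) (v : ℝ)
    (h : ∀ p : stdSimplex ℝ A, ∃ b, ∑ a, p a * M a b ≤ v) :
    ∃ q : stdSimplex ℝ B, ∀ a, ∑ b, q b * M a b ≤ v := by
  classical
  by_contra! hcon
  let φ : (B → ℝ) →ₗ[ℝ] (A → ℝ) :=
    { toFun := fun q a => ∑ b, q b * M a b
      map_add' := fun x y => by ext a; simp [add_mul, Finset.sum_add_distrib]
      map_smul' := fun c x => by ext a; simp [Finset.mul_sum, mul_assoc] }
  have hφ : Continuous φ := φ.continuous_of_finiteDimensional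
  let t : Set (A → ℝ) := {x | ∀ a, x a ≤ v}
  have htc : IsClosed t := by
    have : t = ⋂ a, {x | x a ≤ v} := by ext; simp [t]
    rw [this]
    exact isClosed_iInter fun a => isClosed_le (continuous_apply a) continuous_const
  have htv : Convex ℝ t := by
    intro x hx y hy α β hα hβ hαβ a
    simp only [Pi.add_apply, Pi.smul_apply, smul_eq_mul]
    have h1 := mul_le_mul_of_nonneg_left (hx a) hα
    have h2 := mul_le_mul_of_nonneg_left (hy a) hβ
    have h3 : α * v + β * v = v := by rw [← add_mul, hαβ, one_mul]
    linarith
  have hdisj : Disjoint (φ '' stdSimplex ℝ B) t := by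
    rw [Set.disjoint_left]
    rintro _ ⟨q, hq, rfl⟩ hqt
    obtain ⟨a, ha⟩ := hcon ⟨q, hq⟩
    exact absurd (hqt a) (not_le.2 ha)
  -- The payoff vectors of the mixed columns avoid the orthant `x ≤ v`, so a functional separates
  -- them. As the orthant is unbounded below, the coefficients `c` are nonpositive; `-c`,
  -- normalized, is a mixed row action earning more than `v` against every column.
  obtain ⟨f, u, w, hfu, huw, hfw⟩ := geometric_hahn_banach_compact_closed
    ((convex_stdSimplex ℝ B).linear_image φ) ((isCompact_stdSimplex ℝ B).image hφ) htv htc hdisj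
  let c : A → ℝ := fun a => f (Pi.single a 1)
  have hf : ∀ x, f x = ∑ a, x a * c a := fun x => by
    have := (f : (A → ℝ) →ₗ[ℝ] ℝ).pi_apply_eq_sum_univ x
    simp only [ContinuousLinearMap.coe_coe, smul_eq_mul] at this
    rw [this]
    refine Finset.sum_congr rfl fun a _ => ?_
    congr 2
    ext j
    simp [Pi.single_apply, eq_comm]
  have hw : w < f fun _ => v := hfw _ fun a => le_rfl
  have hc : ∀ a, c a ≤ 0 := by
    intro a
    by_contra! hca
    have hk : 0 ≤ (f (fun _ => v) - w) / c a := div_nonneg (by linarith) hca.le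
    have := hfw ((fun _ => v) - ((f (fun _ => v) - w) / c a) • Pi.single a 1) fun a' => by
      by_cases haa : a' = a
      · subst haa; simpa using hk
      · simp [haa]
    rw [map_sub, map_smul, smul_eq_mul, div_mul_cancel₀ _ hca.ne'] at this
    linarith
  have hσ : 0 < -∑ a, c a := by
    refine lt_of_le_of_ne (neg_nonneg.2 (Finset.sum_nonpos fun a _ => hc a)) fun h0 => ?_
    have hz : ∀ a, c a = 0 := fun a =>
      (Finset.sum_eq_zero_iff_of_nonpos fun a _ => hc a).1 (by linarith) a (Finset.mem_univ a)
    have hf0 : ∀ x, f x = 0 := fun x => by simp [hf, hz]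
    have h1 := hfu _ ⟨_, single_mem_stdSimplex ℝ (Classical.arbitrary B), rfl⟩
    rw [hf0] at h1 hw
    linarith
  obtain ⟨b, hb⟩ := h ⟨fun a => -c a / -∑ a, c a,
    fun a => div_nonneg (neg_nonneg.2 (hc a)) hσ.le, by
      rw [← Finset.sum_div, Finset.sum_neg_distrib, div_self hσ.ne']⟩
  have h1 := hfu _ ⟨_, single_mem_stdSimplex ℝ b, rfl⟩
  have h2 : φ (Pi.single b 1) = fun a => M a b := by
    ext a
    simp [φ, Pi.single_apply]
  rw [h2, hf] at h1
  rw [hf, ← Finset.mul_sum] at hw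
  have h3 : ∀ σ : ℝ, ∑ a, -c a / σ * M a b = -(∑ a, M a b * c a) / σ := fun σ => by
    rw [neg_div, Finset.sum_div, ← Finset.sum_neg_distrib]
    exact Finset.sum_congr rfl fun a _ => by ring
  have h4 : -(∑ a, M a b * c a) / (-∑ a, c a) ≤ v := h3 _ ▸ hb
  rw [div_le_iff₀ hσ] at h4
  linarith

/-- **Von Neumann's minimax theorem**: every finite zero-sum matrix game has a Nash equilibrium. -/
theorem exists_isMatrixNash [Nonempty A] [Nonempty B] (M : A → B → ℝ) :
    ∃ p q, IsMatrixNash M p q := by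
  classical
  let g : stdSimplex ℝ A → ℝ := fun p =>
    Finset.univ.inf' Finset.univ_nonempty fun b => ∑ a, p a * M a b
  have hg : Continuous g := by
    refine Continuous.finset_inf'_apply _ fun b _ => ?_
    refine continuous_finsetSum _ fun a _ => ?_
    exact ((continuous_apply a).comp continuous_subtype_val).mul continuous_const
  obtain ⟨p, -, hp⟩ := isCompact_univ.exists_isMaxOn Set.univ_nonempty hg.continuousOn
  -- `g p` is the best guaranteed payoff, so every `p'` admits a column holding it to at most `g p`.
  obtain ⟨q, hq⟩ := exists_mixed_of_forall_exists_le M (g p) fun p' => by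
    obtain ⟨b, -, hb⟩ := Finset.exists_mem_eq_inf' Finset.univ_nonempty
      fun b => ∑ a, p' a * M a b
    exact ⟨b, hb ▸ hp (Set.mem_univ p')⟩
  have hup : ∀ p', mixedPayoff M p' q ≤ g p := fun p' => by
    rw [mixedPayoff_eq_sum_left]
    exact stdSimplex.sum_mul_le p' hq
  have hlo : ∀ q', g p ≤ mixedPayoff M p q' := fun q' => by
    rw [mixedPayoff_eq_sum_right]
    exact stdSimplex.le_sum_mul q' fun b => Finset.inf'_le _ (Finset.mem_univ b)
  exact ⟨p, q, fun p' => (hup p').trans (hlo q), fun q' => (hup p).trans (hlo q')⟩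

/-- Both payoffs are compared at the crossed pair `(p, q')`, where each equilibrium uses one of its
two inequalities. In particular, all equilibria of a matrix have the same payoff. -/
lemma IsMatrixNash.payoff_le_of_le {M M' : A → B → ℝ} {p p' : stdSimplex ℝ A}
    {q q' : stdSimplex ℝ B} (h : IsMatrixNash M p q) (h' : IsMatrixNash M' p' q') {c : ℝ}
    (hM : ∀ a b, M a b ≤ M' a b + c) : mixedPayoff M p q ≤ mixedPayoff M' p' q' + c :=
  calc mixedPayoff M p q ≤ mixedPayoff M p q' := h.2 q'
    _ ≤ mixedPayoff (fun a b => M' a b + c) p q' := mixedPayoff_mono hM p q'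
    _ = mixedPayoff M' p q' + c := by rw [mixedPayoff_add, mixedPayoff_const]
    _ ≤ mixedPayoff M' p' q' + c := by gcongr; exact h'.1 p

lemma IsMatrixNash.payoff_mono {M M' : A → B → ℝ} {p p' : stdSimplex ℝ A}
    {q q' : stdSimplex ℝ B} (h : IsMatrixNash M p q) (h' : IsMatrixNash M' p' q')
    (hM : ∀ a b, M a b ≤ M' a b) : mixedPayoff M p q ≤ mixedPayoff M' p' q' := by
  simpa using h.payoff_le_of_le h' (c := 0) (by simpa using hM)

lemma IsMatrixNash.payoff_le_sum [DecidableEq B] {M : A → B → ℝ} {p : stdSimplex ℝ A}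
    {q : stdSimplex ℝ B} (h : IsMatrixNash M p q) (b : B) :
    mixedPayoff M p q ≤ ∑ a, p a * M a b :=
  (h.2 _).trans_eq (mixedPayoff_vertex_right M p b)

variable [Nonempty A] [Nonempty B]

/-- An optimal mixed action of the row player. -/
noncomputable def optRow (M : A → B → ℝ) : stdSimplex ℝ A := (exists_isMatrixNash M).choose

/-- An optimal mixed action of the column player. -/
noncomputable def optCol (M : A → B → ℝ) : stdSimplex ℝ B :=
  (exists_isMatrixNash M).choose_spec.choose

/-- The value of a matrix game. -/
noncomputable def matrixValue (M : A → B → ℝ) : ℝ := mixedPayoff M (optRow M) (optCol M)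

lemma isMatrixNash_opt (M : A → B → ℝ) : IsMatrixNash M (optRow M) (optCol M) :=
  (exists_isMatrixNash M).choose_spec.choose_spec

/-- Nonexpansiveness of the value, which makes the Shapley operator a contraction. -/
lemma abs_matrixValue_sub_le {M M' : A → B → ℝ} {c : ℝ} (h : ∀ a b, |M a b - M' a b| ≤ c) :
    |matrixValue M - matrixValue M'| ≤ c := by
  have h1 := (isMatrixNash_opt M).payoff_le_of_le (isMatrixNash_opt M') (c := c) fun a b => by
    linarith [(abs_le.1 (h a b)).2]
  have h2 := (isMatrixNash_opt M').payoff_le_of_le (isMatrixNash_opt M) (c := c) fun a b => by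
    linarith [(abs_le.1 (h a b)).1]
  rw [abs_le]
  unfold matrixValue
  constructor <;> linarith

end MatrixGame

/-! ### Cesàro averages of stochastic matrices -/

section RowStochastic

open Matrix

variable {S : Type*} [Fintype S] [DecidableEq S] {K : Matrix S S ℝ}

lemma mulVec_le_of_mem_rowStochastic (hK : K ∈ rowStochastic ℝ S) {f : S → ℝ} {c : ℝ}
    (h : ∀ x, f x ≤ c) (s : S) : (K *ᵥ f) s ≤ c :=
  calc (K *ᵥ f) s ≤ ∑ x, K s x * c := Finset.sum_le_sum fun x _ =>
        mul_le_mul_of_nonneg_left (h x) (nonneg_of_mem_rowStochastic hK)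
    _ = c := by rw [← Finset.sum_mul, sum_row_of_mem_rowStochastic hK, one_mul]

lemma le_mulVec_of_mem_rowStochastic (hK : K ∈ rowStochastic ℝ S) {f : S → ℝ} {c : ℝ}
    (h : ∀ x, c ≤ f x) (s : S) : c ≤ (K *ᵥ f) s := by
  have := mulVec_le_of_mem_rowStochastic hK (f := -f) (c := -c) (fun x => neg_le_neg (h x)) s
  rw [mulVec_neg, Pi.neg_apply] at this
  linarith

lemma abs_mulVec_le_of_mem_rowStochastic (hK : K ∈ rowStochastic ℝ S) (f : S → ℝ) (s : S) :
    |(K *ᵥ f) s| ≤ ‖f‖ :=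
  abs_le.2 ⟨le_mulVec_of_mem_rowStochastic hK (fun x => (abs_le.1 (norm_le_pi_norm f x)).1) s,
    mulVec_le_of_mem_rowStochastic hK (fun x => (abs_le.1 (norm_le_pi_norm f x)).2) s⟩

lemma tendsto_const_div_natCast_of_bounded {f : ℕ → ℝ} {c : ℝ} (h : ∀ n, |f n| ≤ c) :
    Tendsto (fun n : ℕ => f n / n) atTop (𝓝 0) := by
  refine squeeze_zero_norm (a := fun n : ℕ => c / n) (fun n => ?_)
    (tendsto_const_div_atTop_nhds_zero_nat c)
  rw [Real.norm_eq_abs, abs_div, Nat.abs_cast]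
  gcongr
  exact h n

/-- The fixed vectors and the coboundaries of a stochastic matrix span the whole space. -/
lemma exists_eq_add_mulVec_sub (hK : K ∈ rowStochastic ℝ S) (r : S → ℝ) :
    ∃ u w : S → ℝ, K *ᵥ u = u ∧ r = u + (K *ᵥ w - w) := by
  let g : (S → ℝ) →ₗ[ℝ] (S → ℝ) := K.mulVecLin - 1
  have hg : ∀ x, g x = K *ᵥ x - x := fun x => rfl
  have hd : Disjoint (LinearMap.ker g) (LinearMap.range g) := by
    rw [Submodule.disjoint_def]
    rintro y hy ⟨x, rfl⟩
    have hfix : K *ᵥ g x = g x := by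
      have : g (g x) = 0 := hy
      rw [hg (g x), sub_eq_zero] at this
      exact this
    -- If `g x` is a fixed vector, the orbit of `x` grows linearly with slope `g x`; it is also
    -- bounded, so the slope is zero. Rank-nullity turns this disjointness into a decomposition of
    -- the whole space.
    have hpow : ∀ n : ℕ, K ^ n *ᵥ x = x + (n : ℝ) • g x := by
      intro n
      induction n with
      | zero => simp
      | succ n ih =>
        rw [pow_succ', ← mulVec_mulVec, ih, mulVec_add, mulVec_smul, hfix]
        have : K *ᵥ x = x + g x := by rw [hg]; abel
        rw [this]
        push_cast
        rw [add_smul, one_smul]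
        abel
    ext s
    have hlim := tendsto_const_div_natCast_of_bounded
      (fun n => abs_mulVec_le_of_mem_rowStochastic (pow_mem hK n) x s)
    have hlim2 : Tendsto (fun n : ℕ => (K ^ n *ᵥ x) s / n) atTop (𝓝 (0 + g x s)) := by
      refine Tendsto.congr' ?_
        ((tendsto_const_div_atTop_nhds_zero_nat (x s)).add_const (g x s))
      filter_upwards [eventually_gt_atTop 0] with n hn
      have hn' : (n : ℝ) ≠ 0 := by positivity
      rw [hpow]
      simp only [Pi.add_apply, Pi.smul_apply, smul_eq_mul]
      field_simp
    simpa using (tendsto_nhds_unique hlim hlim2).symm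
  have htop := Submodule.eq_top_of_disjoint _ _ (by
    rw [add_comm, LinearMap.finrank_range_add_finrank_ker]) hd
  obtain ⟨u, hu, _, ⟨w, rfl⟩, huw⟩ := Submodule.mem_sup.1 (htop ▸ Submodule.mem_top : r ∈ _)
  refine ⟨u, w, ?_, by rw [← huw, hg]⟩
  have : g u = 0 := hu
  rw [hg, sub_eq_zero] at this
  exact this

/-- The **mean ergodic theorem** for stochastic matrices. -/
theorem exists_tendsto_cesaro (hK : K ∈ rowStochastic ℝ S) (r : S → ℝ) (s : S) :
    ∃ l, Tendsto (fun n : ℕ => (∑ t ∈ Finset.range n, (K ^ t *ᵥ r) s) / n) atTop (𝓝 l) := by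
  obtain ⟨u, w, hu, rfl⟩ := exists_eq_add_mulVec_sub hK r
  refine ⟨u s, ?_⟩
  have hu' : ∀ t : ℕ, K ^ t *ᵥ u = u := fun t => by
    induction t with
    | zero => simp
    | succ t ih => rw [pow_succ, ← mulVec_mulVec, hu, ih]
  have hsum : ∀ n : ℕ, ∑ t ∈ Finset.range n, (K ^ t *ᵥ (u + (K *ᵥ w - w))) s
      = n * u s + ((K ^ n *ᵥ w) s - w s) := by
    intro n
    induction n with
    | zero => simp
    | succ n ih =>
      rw [Finset.sum_range_succ, ih, mulVec_add, mulVec_sub, hu', mulVec_mulVec, ← pow_succ]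
      simp only [Pi.add_apply, Pi.sub_apply]
      push_cast
      ring
  have h1 : ∀ n : ℕ, |(K ^ n *ᵥ w) s - w s| ≤ ‖w‖ + ‖w‖ := fun n =>
    (abs_sub _ _).trans
      (add_le_add (abs_mulVec_le_of_mem_rowStochastic (pow_mem hK n) w s) (norm_le_pi_norm w s))
  have h2 := (tendsto_const_div_natCast_of_bounded h1).const_add (u s)
  rw [add_zero] at h2
  refine h2.congr' ?_
  filter_upwards [eventually_gt_atTop 0] with n hn
  have hn' : (n : ℝ) ≠ 0 := by positivity
  rw [hsum]
  field_simp

/-- A superharmonicity certificate bounds the Cesàro limit from above. -/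
lemma cesaro_limit_le (hK : K ∈ rowStochastic ℝ S) {r V : S → ℝ} {c l : ℝ} {s : S}
    (h : ∀ x, r x + (K *ᵥ V) x ≤ V x + c)
    (hl : Tendsto (fun n : ℕ => (∑ t ∈ Finset.range n, (K ^ t *ᵥ r) s) / n) atTop (𝓝 l)) :
    l ≤ c := by
  have hstep : ∀ t : ℕ, (K ^ t *ᵥ r) s ≤ (K ^ t *ᵥ V) s - (K ^ (t + 1) *ᵥ V) s + c := by
    intro t
    have := mulVec_le_of_mem_rowStochastic (pow_mem hK t) (f := r + (K *ᵥ V - V)) (c := c)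
      (fun x => by simp only [Pi.add_apply, Pi.sub_apply]; linarith [h x]) s
    rw [mulVec_add, mulVec_sub, mulVec_mulVec, ← pow_succ] at this
    simp only [Pi.add_apply, Pi.sub_apply] at this
    linarith
  have hsum : ∀ n : ℕ, ∑ t ∈ Finset.range n, (K ^ t *ᵥ r) s
      ≤ (V s - (K ^ n *ᵥ V) s) + n * c := by
    intro n
    induction n with
    | zero => simp
    | succ n ih =>
      rw [Finset.sum_range_succ]
      push_cast
      linarith [hstep n]
  have h1 : ∀ n : ℕ, |V s - (K ^ n *ᵥ V) s| ≤ ‖V‖ + ‖V‖ := fun n =>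
    (abs_sub _ _).trans
      (add_le_add (norm_le_pi_norm V s) (abs_mulVec_le_of_mem_rowStochastic (pow_mem hK n) V s))
  have h2 := (tendsto_const_div_natCast_of_bounded h1).add_const c
  rw [zero_add] at h2
  refine le_of_tendsto_of_tendsto hl h2 ?_
  filter_upwards [eventually_gt_atTop 0] with n hn
  have hn' : (0 : ℝ) < n := by positivity
  rw [div_le_iff₀ hn', add_mul, div_mul_cancel₀ _ hn'.ne']
  linarith [hsum n]

/-- A subharmonicity certificate bounds the Cesàro limit from below. -/
lemma le_cesaro_limit (hK : K ∈ rowStochastic ℝ S) {r V : S → ℝ} {c l : ℝ} {s : S}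
    (h : ∀ x, V x + c ≤ r x + (K *ᵥ V) x)
    (hl : Tendsto (fun n : ℕ => (∑ t ∈ Finset.range n, (K ^ t *ᵥ r) s) / n) atTop (𝓝 l)) :
    c ≤ l := by
  refine neg_le_neg_iff.1 (cesaro_limit_le hK (r := -r) (V := -V) (s := s) (fun x => ?_) ?_)
  · rw [mulVec_neg]
    simp only [Pi.neg_apply]
    linarith [h x]
  · refine hl.neg.congr fun n => ?_
    simp only [mulVec_neg, Pi.neg_apply, Finset.sum_neg_distrib, neg_div]

end RowStochastic

/-! ### Discounted values and the average-reward value -/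

namespace StochasticGame

open Matrix

variable {S A B : Type*} [Fintype S] (G : StochasticGame S A B)

/-- The expectation of `V` at the next state. -/
def nextValue (V : S → ℝ) (s : S) (a : A) (b : B) : ℝ := ∑ z, G.P s a b z * V z

/-- The one-step lookahead of `V` with discount factor `1 - 1 / H`. -/
noncomputable def lookahead (H : ℝ) (V : S → ℝ) (s : S) (a : A) (b : B) : ℝ :=
  G.r s a b + (1 - 1 / H) * G.nextValue V s a b

/-- `V` solves the Shapley equations of the game with discount factor `1 - 1 / H`. -/
def IsDiscountedValue [Fintype A] [Fintype B] [Nonempty A] [Nonempty B] (H : ℝ) (V : S → ℝ) : Prop :=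
  ∀ s, V s = matrixValue (G.lookahead H V s)

variable {G}

lemma nextValue_le {V : S → ℝ} {c : ℝ} (h : ∀ z, V z ≤ c) (s : S) (a : A) (b : B) :
    G.nextValue V s a b ≤ c :=
  stdSimplex.sum_mul_le _ h

lemma le_nextValue {V : S → ℝ} {c : ℝ} (h : ∀ z, c ≤ V z) (s : S) (a : A) (b : B) :
    c ≤ G.nextValue V s a b :=
  stdSimplex.le_sum_mul _ h

lemma abs_nextValue_sub_le {V V' : S → ℝ} {c : ℝ} (h : ∀ z, |V z - V' z| ≤ c)
    (s : S) (a : A) (b : B) : |G.nextValue V s a b - G.nextValue V' s a b| ≤ c := by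
  have : G.nextValue V s a b - G.nextValue V' s a b = G.nextValue (V - V') s a b := by
    simp [nextValue, mul_sub]
  rw [this, abs_le]
  exact ⟨le_nextValue (fun z => (abs_le.1 (h z)).1) s a b,
    nextValue_le (fun z => (abs_le.1 (h z)).2) s a b⟩

lemma discount_nonneg {H : ℝ} (hH : 1 < H) : 0 ≤ 1 - 1 / H := by
  rw [sub_nonneg, div_le_one (by linarith)]
  exact hH.le

variable [Fintype A] [Fintype B]

/-- Shapley's argument: the one-step operator contracts the sup norm by `1 - 1 / H`, so Banach's
theorem gives a fixed point. -/
theorem exists_isDiscountedValue [Nonempty A] [Nonempty B] {H : ℝ} (hH : 1 < H) :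
    ∃ V, G.IsDiscountedValue H V := by
  have h0 : 0 < H := by linarith
  have hlt : (1 - 1 / H).toNNReal < 1 := by
    rw [Real.toNNReal_lt_one]
    have : 0 < 1 / H := by positivity
    linarith
  have hc : ContractingWith (1 - 1 / H).toNNReal
      fun (V : S → ℝ) s => matrixValue (G.lookahead H V s) := by
    refine ⟨hlt, LipschitzWith.of_dist_le_mul fun V V' => ?_⟩
    refine (dist_pi_le_iff (by positivity)).2 fun s => ?_
    rw [Real.dist_eq]
    refine abs_matrixValue_sub_le fun a b => ?_
    have h1 : |G.nextValue V s a b - G.nextValue V' s a b| ≤ dist V V' :=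
      abs_nextValue_sub_le (fun z => (Real.dist_eq _ _) ▸ dist_le_pi_dist V V' z) s a b
    have h2 : G.lookahead H V s a b - G.lookahead H V' s a b
        = (1 - 1 / H) * (G.nextValue V s a b - G.nextValue V' s a b) := by
      simp only [lookahead]; ring
    rw [h2, abs_mul, abs_of_nonneg (discount_nonneg hH), Real.coe_toNNReal _ (discount_nonneg hH)]
    exact mul_le_mul_of_nonneg_left h1 (discount_nonneg hH)
  exact ⟨_, fun s => (congrFun hc.fixedPoint_isFixedPt s).symm⟩

lemma rewardOf_mem (μ : MarkovPolicy S A) (ν : MarkovPolicy S B) (s : S) :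
    G.rewardOf μ ν s ∈ Set.Icc (0 : ℝ) 1 :=
  ⟨(mixedPayoff_const (A := A) (B := B) 0 (μ s) (ν s)).symm.trans_le
      (mixedPayoff_mono (fun a b => (G.r_mem s a b).1) _ _),
    (mixedPayoff_mono (fun a b => (G.r_mem s a b).2) _ _).trans_eq (mixedPayoff_const 1 _ _)⟩

lemma kernelOf_mulVec (μ : MarkovPolicy S A) (ν : MarkovPolicy S B) (V : S → ℝ) (s : S) :
    (G.kernelOf μ ν *ᵥ V) s = mixedPayoff (G.nextValue V s) (μ s) (ν s) := by
  have : G.nextValue V s = fun a b => ∑ z, V z * G.P s a b z := by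
    ext a b; simp [nextValue, mul_comm]
  rw [this, mixedPayoff_sum]
  simp only [mixedPayoff_const_mul, mulVec, dotProduct, kernelOf, mul_comm]

lemma mixedPayoff_lookahead (H : ℝ) (V : S → ℝ) (μ : MarkovPolicy S A) (ν : MarkovPolicy S B)
    (s : S) : mixedPayoff (G.lookahead H V s) (μ s) (ν s)
      = G.rewardOf μ ν s + (1 - 1 / H) * (G.kernelOf μ ν *ᵥ V) s := by
  rw [kernelOf_mulVec, ← mixedPayoff_const_mul]
  exact mixedPayoff_add _ _ _ _

section

variable [Nonempty A] [Nonempty B]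

namespace IsDiscountedValue

variable {H : ℝ} {V : S → ℝ}

/-- At a maximizer `x` of `V`, the Shapley equation gives `V x ≤ 1 + (1 - 1 / H) * V x`. -/
lemma le_horizon (hH : 1 < H) (hV : G.IsDiscountedValue H V) (s : S) : V s ≤ H := by
  have : Nonempty S := ⟨s⟩
  obtain ⟨x, hx⟩ := Finite.exists_max V
  have h1 : V x ≤ 1 + (1 - 1 / H) * V x :=
    calc V x = matrixValue (G.lookahead H V x) := hV x
      _ ≤ mixedPayoff (fun _ _ => 1 + (1 - 1 / H) * V x) (optRow (G.lookahead H V x))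
          (optCol (G.lookahead H V x)) := mixedPayoff_mono (fun a b => add_le_add
            (G.r_mem x a b).2 (mul_le_mul_of_nonneg_left (nextValue_le hx x a b)
              (discount_nonneg hH))) _ _
      _ = _ := mixedPayoff_const _ _ _
  have h2 : V x / H ≤ 1 := by
    have : (1 - 1 / H) * V x = V x - V x / H := by ring
    linarith
  rw [div_le_one (by linarith)] at h2
  exact (hx s).trans h2

lemma nonneg (hH : 1 < H) (hV : G.IsDiscountedValue H V) (s : S) : 0 ≤ V s := by
  have : Nonempty S := ⟨s⟩
  obtain ⟨x, hx⟩ := Finite.exists_min V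
  have h1 : 0 + (1 - 1 / H) * V x ≤ V x :=
    calc 0 + (1 - 1 / H) * V x = mixedPayoff (fun _ _ => 0 + (1 - 1 / H) * V x)
          (optRow (G.lookahead H V x)) (optCol (G.lookahead H V x)) :=
          (mixedPayoff_const _ _ _).symm
      _ ≤ matrixValue (G.lookahead H V x) := mixedPayoff_mono (fun a b => add_le_add
            (G.r_mem x a b).1 (mul_le_mul_of_nonneg_left (le_nextValue hx x a b)
              (discount_nonneg hH))) _ _
      _ = V x := (hV x).symm
  have h2 : 0 ≤ V x / H := by
    have : (1 - 1 / H) * V x = V x - V x / H := by ring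
    linarith
  have h3 : 0 ≤ V x := by
    have := mul_nonneg h2 (by linarith : (0 : ℝ) ≤ H)
    rwa [div_mul_cancel₀ _ (by linarith)] at this
  exact h3.trans (hx s)

/-- Against the optimal policy of the min-player, `V` is superharmonic. -/
lemma reward_add_le (hV : G.IsDiscountedValue H V) (μ : MarkovPolicy S A) (s : S) :
    G.rewardOf μ (fun s => optCol (G.lookahead H V s)) s
      + (1 - 1 / H) * (G.kernelOf μ (fun s => optCol (G.lookahead H V s)) *ᵥ V) s ≤ V s := by
  rw [← mixedPayoff_lookahead, hV s]
  exact (isMatrixNash_opt (G.lookahead H V s)).1 (μ s)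

/-- Under the optimal policy of the max-player, `V` is subharmonic. -/
lemma le_reward_add (hV : G.IsDiscountedValue H V) (ν : MarkovPolicy S B) (s : S) :
    V s ≤ G.rewardOf (fun s => optRow (G.lookahead H V s)) ν s
      + (1 - 1 / H) * (G.kernelOf (fun s => optRow (G.lookahead H V s)) ν *ᵥ V) s := by
  rw [← mixedPayoff_lookahead, hV s]
  exact (isMatrixNash_opt (G.lookahead H V s)).2 (ν s)

end IsDiscountedValue

end

/-! ### Markov chains of fixed policies, hitting times and the average-reward value -/

variable [DecidableEq S]

lemma kernelOf_mem (μ : MarkovPolicy S A) (ν : MarkovPolicy S B) :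
    G.kernelOf μ ν ∈ rowStochastic ℝ S := by
  refine mem_rowStochastic.2 ⟨fun s x => ?_, funext fun s => ?_⟩
  · exact (mixedPayoff_const (A := A) (B := B) 0 (μ s) (ν s)).symm.trans_le
      (mixedPayoff_mono (fun a b => stdSimplex.zero_le _ _) _ _)
  · rw [kernelOf_mulVec]
    have : G.nextValue 1 s = fun a b => 1 := by ext a b; simp [nextValue]
    rw [this, mixedPayoff_const, Pi.one_apply]

lemma tendsto_avgReward (μ : MarkovPolicy S A) (ν : MarkovPolicy S B) (s : S) :
    Tendsto (fun n : ℕ =>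
      (∑ t ∈ Finset.range n, (G.kernelOf μ ν ^ t *ᵥ G.rewardOf μ ν) s) / n) atTop
      (𝓝 (G.avgReward μ ν s)) :=
  tendsto_nhds_limUnder (exists_tendsto_cesaro (kernelOf_mem μ ν) (G.rewardOf μ ν) s)

lemma avgReward_mem (μ : MarkovPolicy S A) (ν : MarkovPolicy S B) (s : S) :
    G.avgReward μ ν s ∈ Set.Icc (0 : ℝ) 1 :=
  ⟨le_cesaro_limit (kernelOf_mem μ ν) (V := 0)
      (fun x => by simpa using (rewardOf_mem μ ν x).1) (tendsto_avgReward μ ν s),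
    cesaro_limit_le (kernelOf_mem μ ν) (V := 0)
      (fun x => by simpa using (rewardOf_mem μ ν x).2) (tendsto_avgReward μ ν s)⟩

lemma avoidProb_nonneg (μ : MarkovPolicy S A) (ν : MarkovPolicy S B) (s' : S) (n : ℕ) (s : S) :
    0 ≤ G.avoidProb μ ν s' n s := by
  induction n generalizing s with
  | zero => rw [avoidProb]; split_ifs <;> norm_num
  | succ n ih =>
    rw [avoidProb]
    split_ifs
    · exact le_rfl
    · exact Finset.sum_nonneg fun x _ =>
        mul_nonneg (nonneg_of_mem_rowStochastic (kernelOf_mem μ ν)) (ih x)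

/-- A function that vanishes at `s'` and decreases by at most one in expectation at each step is
bounded by the expected hitting time of `s'`. -/
lemma le_sum_avoidProb {μ : MarkovPolicy S A} {ν : MarkovPolicy S B} {s' : S} {g : S → ℝ} {c : ℝ}
    (h0 : g s' = 0) (hc : ∀ s, g s ≤ c) (hg : ∀ s, g s ≤ 1 + (G.kernelOf μ ν *ᵥ g) s)
    (n : ℕ) (s : S) :
    g s ≤ ∑ k ∈ Finset.range n, G.avoidProb μ ν s' k s + c * G.avoidProb μ ν s' n s := by
  induction n generalizing s with
  | zero =>
    rw [avoidProb]
    split_ifs with h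
    · subst h; simp [h0]
    · simpa using hc s
  | succ n ih =>
    by_cases h : s = s'
    · subst h
      have : ∀ k, G.avoidProb μ ν s k s = 0 := fun k => by cases k <;> simp [avoidProb]
      simp [this, h0]
    · have hsucc : ∀ k, G.avoidProb μ ν s' (k + 1) s
          = (G.kernelOf μ ν *ᵥ G.avoidProb μ ν s' k) s := fun k => by
        rw [avoidProb, if_neg h]; rfl
      have hz : G.avoidProb μ ν s' 0 s = 1 := by rw [avoidProb, if_neg h]
      have hle : (G.kernelOf μ ν *ᵥ g) s ≤ (G.kernelOf μ ν *ᵥ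
          (∑ k ∈ Finset.range n, G.avoidProb μ ν s' k + c • G.avoidProb μ ν s' n)) s := by
        refine Finset.sum_le_sum fun x _ => mul_le_mul_of_nonneg_left ?_
          (nonneg_of_mem_rowStochastic (kernelOf_mem μ ν))
        simpa using ih x
      rw [mulVec_add, mulVec_smul, Matrix.mulVec_sum] at hle
      simp only [Pi.add_apply, Finset.sum_apply, Pi.smul_apply, smul_eq_mul] at hle
      rw [Finset.sum_range_succ', hz, hsucc n]
      simp only [hsucc]
      linarith [hg s]

variable [Nonempty A] [Nonempty B]

namespace IsDiscountedValue

variable {H : ℝ} {V : S → ℝ}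

/-- The span of the discounted value is at most the diameter. -/
theorem sub_le_diameter (hH : 1 < H) (hV : G.IsDiscountedValue H V) {D : ℝ≥0}
    (hD : G.diameter ≤ D) (s s' : S) : V s' - V s ≤ D := by
  have hpos : 0 < H := by linarith
  set ν : MarkovPolicy S B := fun s => optCol (G.lookahead H V s) with hν
  refine le_of_forall_pos_le_add fun ε hε => ?_
  have hinf : (⨅ μ : MarkovPolicy S A, G.expHittingTime μ ν s s') < (D : ℝ≥0∞) + ENNReal.ofReal ε :=
    calc _ ≤ G.diameter := le_iSup_of_le s (le_iSup_of_le s' (le_iSup_of_le ν le_rfl))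
      _ ≤ D := hD
      _ < _ := ENNReal.lt_add_right ENNReal.coe_ne_top (by simpa using hε)
  obtain ⟨μ, hμ⟩ := iInf_lt_iff.1 hinf
  -- Superharmonicity and `0 ≤ r` give `K V - K V / H ≤ V`, and `K V ≤ H` makes the discount loss at
  -- most one per step, which is the decrease that the hitting-time bound allows. The remainder `H *
  -- avoidProb` vanishes in the limit because the expected hitting time is finite.
  have hcert := le_sum_avoidProb (G := G) (μ := μ) (ν := ν) (s' := s') (g := fun x => V s' - V x)
    (c := H) (sub_self _) (fun x => by linarith [hV.le_horizon hH s', hV.nonneg hH x]) (fun x => by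
      have h1 := hV.reward_add_le μ x
      rw [← hν] at h1
      have h2 := (rewardOf_mem (G := G) μ ν x).1
      have h3 : (G.kernelOf μ ν *ᵥ V) x ≤ H :=
        mulVec_le_of_mem_rowStochastic (kernelOf_mem μ ν) (hV.le_horizon hH) x
      have h4 : (G.kernelOf μ ν *ᵥ fun x => V s' - V x) x = V s' - (G.kernelOf μ ν *ᵥ V) x := by
        have : (fun x => V s' - V x) = V s' • (1 : S → ℝ) - V := by ext; simp
        rw [this, mulVec_sub, mulVec_smul, one_vecMul_of_mem_rowStochastic (kernelOf_mem μ ν)]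
        simp
      have h5 : (G.kernelOf μ ν *ᵥ V) x / H ≤ 1 := (div_le_one hpos).2 h3
      have h6 : (1 - 1 / H) * (G.kernelOf μ ν *ᵥ V) x
          = (G.kernelOf μ ν *ᵥ V) x - (G.kernelOf μ ν *ᵥ V) x / H := by ring
      rw [h4]
      linarith)
  have hsum : ∀ n, ∑ k ∈ Finset.range n, G.avoidProb μ ν s' k s ≤ D + ε := by
    intro n
    have h1 : ENNReal.ofReal (∑ k ∈ Finset.range n, G.avoidProb μ ν s' k s)
        ≤ ENNReal.ofReal (D + ε) := by
      rw [ENNReal.ofReal_sum_of_nonneg fun k _ => avoidProb_nonneg μ ν s' k s,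
        ENNReal.ofReal_add D.coe_nonneg hε.le, ENNReal.ofReal_coe_nnreal]
      exact (ENNReal.sum_le_tsum _).trans hμ.le
    exact (ENNReal.ofReal_le_ofReal_iff (add_nonneg D.coe_nonneg hε.le)).1 h1
  have hlim : Tendsto (fun n => G.avoidProb μ ν s' n s) atTop (𝓝 0) := by
    have h1 := ENNReal.tendsto_atTop_zero_of_tsum_ne_top
      (hμ.trans_le le_top).ne
    have h2 := (ENNReal.tendsto_toReal ENNReal.zero_ne_top).comp h1
    simpa [Function.comp_def, ENNReal.toReal_ofReal (avoidProb_nonneg _ _ _ _ _)] using h2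
  have hlim2 : Tendsto (fun n => (D : ℝ) + ε + H * G.avoidProb μ ν s' n s) atTop
      (𝓝 (D + ε + H * 0)) := (hlim.const_mul H).const_add _
  rw [mul_zero, add_zero] at hlim2
  exact ge_of_tendsto' hlim2 fun n => (hcert n s).trans (by linarith [hsum n])

/-- Removing the discount from the Shapley inequality adds `K V / H ≤ c / H`, so `V` is a
certificate for the undiscounted chain with constant `c / H`. -/
lemma avgReward_le (hH : 1 < H) (hV : G.IsDiscountedValue H V) {c : ℝ} (hc : ∀ s, V s ≤ c)
    (μ : MarkovPolicy S A) (s : S) :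
    G.avgReward μ (fun s => optCol (G.lookahead H V s)) s ≤ c / H := by
  have hpos : 0 < H := by linarith
  refine cesaro_limit_le (kernelOf_mem _ _) (V := V) (fun x => ?_) (tendsto_avgReward _ _ s)
  have h1 := hV.reward_add_le μ x
  have h3 := div_le_div_of_nonneg_right (mulVec_le_of_mem_rowStochastic
    (kernelOf_mem (G := G) μ fun s => optCol (G.lookahead H V s)) hc x) hpos.le
  rw [sub_mul, one_mul, one_div_mul_eq_div] at h1
  linarith

lemma le_avgReward (hH : 1 < H) (hV : G.IsDiscountedValue H V) {c : ℝ} (hc : ∀ s, c ≤ V s)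
    (ν : MarkovPolicy S B) (s : S) :
    c / H ≤ G.avgReward (fun s => optRow (G.lookahead H V s)) ν s := by
  have hpos : 0 < H := by linarith
  refine le_cesaro_limit (kernelOf_mem _ _) (V := V) (fun x => ?_) (tendsto_avgReward _ _ s)
  have h1 := hV.le_reward_add ν x
  have h3 := div_le_div_of_nonneg_right (le_mulVec_of_mem_rowStochastic
    (kernelOf_mem (G := G) (fun s => optRow (G.lookahead H V s)) ν) hc x) hpos.le
  rw [sub_mul, one_mul, one_div_mul_eq_div] at h1
  linarith

end IsDiscountedValue

/-- A game of finite diameter has an average-reward value, which is close to the normalized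
discounted values. -/
theorem exists_isGameValue [Nonempty S] {D : ℝ≥0} (hD : G.diameter ≤ D) :
    ∃ J, G.IsGameValue J ∧ J ≤ 1 ∧
      ∀ H, 1 < H → ∀ V, G.IsDiscountedValue H V → ∀ s, J ≤ (V s + D) / H := by
  let lo : S → ℝ := fun s => ⨆ μ : MarkovPolicy S A, ⨅ ν : MarkovPolicy S B, G.avgReward μ ν s
  let hi : S → ℝ := fun s => ⨅ ν : MarkovPolicy S B, ⨆ μ : MarkovPolicy S A, G.avgReward μ ν s
  have bddB : ∀ μ s, BddBelow (Set.range fun ν : MarkovPolicy S B => G.avgReward μ ν s) :=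
    fun μ s => ⟨0, Set.forall_mem_range.2 fun ν => (avgReward_mem μ ν s).1⟩
  have bddA : ∀ ν s, BddAbove (Set.range fun μ : MarkovPolicy S A => G.avgReward μ ν s) :=
    fun ν s => ⟨1, Set.forall_mem_range.2 fun μ => (avgReward_mem μ ν s).2⟩
  have bddA' : ∀ s, BddAbove (Set.range fun μ : MarkovPolicy S A =>
      ⨅ ν : MarkovPolicy S B, G.avgReward μ ν s) := fun s =>
    ⟨1, Set.forall_mem_range.2 fun μ => (ciInf_le (bddB μ s) (Classical.arbitrary _)).trans
      (avgReward_mem μ _ s).2⟩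
  have bddB' : ∀ s, BddBelow (Set.range fun ν : MarkovPolicy S B =>
      ⨆ μ : MarkovPolicy S A, G.avgReward μ ν s) := fun s =>
    ⟨0, Set.forall_mem_range.2 fun ν => (avgReward_mem (Classical.arbitrary _) ν s).1.trans
      (le_ciSup (bddA ν s) _)⟩
  have hlohi : ∀ s, lo s ≤ hi s := fun s =>
    ciSup_le fun μ => le_ciInf fun ν => (ciInf_le (bddB μ s) ν).trans (le_ciSup (bddA ν s) μ)
  have hlo : ∀ H, 1 < H → ∀ V, G.IsDiscountedValue H V → ∀ s x, (V x - D) / H ≤ lo s :=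
    fun H hH V hV s x => le_trans (le_ciInf fun ν => hV.le_avgReward hH (fun y => by
      linarith [hV.sub_le_diameter hH hD y x]) ν s) (le_ciSup (bddA' s) _)
  have hhi : ∀ H, 1 < H → ∀ V, G.IsDiscountedValue H V → ∀ s x, hi s ≤ (V x + D) / H :=
    fun H hH V hV s x => le_trans (ciInf_le (bddB' s) _) (ciSup_le fun μ =>
      hV.avgReward_le hH (fun y => by linarith [hV.sub_le_diameter hH hD x y]) μ s)
  -- The values do not involve the discount, so the horizon `n` is free: the gap is at most `2 * D /
  -- n` for every `n > 1`. Different initial states are compared at once, which makes the value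
  -- independent of the state.
  have hclose : ∀ s x, hi s ≤ lo x := by
    intro s x
    have hlim : Tendsto (fun n : ℕ => lo x + 2 * D / (n : ℝ)) atTop (𝓝 (lo x + 0)) :=
      (tendsto_const_div_atTop_nhds_zero_nat _).const_add _
    rw [add_zero] at hlim
    refine ge_of_tendsto hlim ?_
    filter_upwards [eventually_gt_atTop 1] with n hn
    have hn' : (1 : ℝ) < n := by exact_mod_cast hn
    obtain ⟨V, hV⟩ := exists_isDiscountedValue (G := G) hn'
    have h1 := hhi n hn' V hV s x
    have h2 := hlo n hn' V hV x x
    have h3 : (V x + D) / (n : ℝ) = (V x - D) / n + 2 * D / n := by ring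
    linarith
  obtain ⟨s₀⟩ := ‹Nonempty S›
  refine ⟨lo s₀, fun s => ⟨?_, ?_⟩, ?_, fun H hH V hV s => ?_⟩
  · exact le_antisymm ((hlohi s).trans (hclose s s₀)) ((hlohi s₀).trans (hclose s₀ s))
  · exact le_antisymm (hclose s s₀) ((hlohi s₀).trans ((hclose s₀ s).trans (hlohi s)))
  · exact ciSup_le fun μ => (ciInf_le (bddB μ s₀) (Classical.arbitrary _)).trans
      (avgReward_mem μ _ s₀).2
  · exact (hlohi s₀).trans (hhi H hH V hV s₀ s)

end StochasticGame

/-! ### Running averages with the learning rates `alpha` -/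

namespace DONQ

section Alpha

variable {H : ℝ}

lemma alpha_one (hH : 1 < H) : alpha H 1 = 1 := by
  rw [alpha, Nat.cast_one, div_self (by linarith)]

lemma alpha_nonneg (hH : 1 < H) (n : ℕ) : 0 ≤ alpha H n := by
  have : (0 : ℝ) ≤ n := n.cast_nonneg
  exact div_nonneg (by linarith) (by linarith)

lemma alpha_succ (H : ℝ) (n : ℕ) : alpha H (n + 1) = (H + 1) / (H + n + 1) := by
  rw [alpha]; push_cast; rw [add_assoc]

lemma one_sub_alpha_succ (hH : 1 < H) (n : ℕ) : 1 - alpha H (n + 1) = n / (H + n + 1) := by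
  have : (0 : ℝ) ≤ n := n.cast_nonneg
  rw [alpha_succ, eq_div_iff (by linarith), sub_mul, div_mul_cancel₀ _ (by linarith)]
  ring

lemma one_sub_alpha_succ_nonneg (hH : 1 < H) (n : ℕ) : 0 ≤ 1 - alpha H (n + 1) := by
  rw [one_sub_alpha_succ hH]
  have : (0 : ℝ) ≤ n := n.cast_nonneg
  exact div_nonneg this (by linarith)

/-- The weight `α_i ∏_{i < j ≤ n} (1 - α_j)` of the `i`-th sample in the average of the first `n`
samples, for `1 ≤ i ≤ n`. -/
noncomputable def weight (H : ℝ) : ℕ → ℕ → ℝ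
  | 0, _ => 0
  | n + 1, i => if i = n + 1 then alpha H (n + 1) else (1 - alpha H (n + 1)) * weight H n i

lemma weight_eq_zero_of_lt {n i : ℕ} (h : n < i) : weight H n i = 0 := by
  induction n with
  | zero => rfl
  | succ n ih => rw [weight, if_neg (by omega), ih (by omega), mul_zero]

lemma weight_nonneg (hH : 1 < H) (n i : ℕ) : 0 ≤ weight H n i := by
  induction n with
  | zero => exact le_rfl
  | succ n ih =>
    rw [weight]
    split_ifs
    · exact alpha_nonneg hH _
    · exact mul_nonneg (one_sub_alpha_succ_nonneg hH n) ih

/-- The sum of squares satisfies `σ' = (1 - α) ^ 2 * σ + α ^ 2`, and the bound passes through this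
recursion. It supplies the variance of an average of `n` samples, hence the shape `√(H / n)` of the
bonus. -/
lemma sum_sq_weight_le_of_eq (hH : 1 < H) (n : ℕ) :
    (n + 1) * ∑ i ∈ Finset.range (n + 1), weight H (n + 1) (i + 1) ^ 2 ≤ 2 * H := by
  have hrec : ∀ n, ∑ i ∈ Finset.range (n + 1), weight H (n + 1) (i + 1) ^ 2
      = (n / (H + n + 1)) ^ 2 * ∑ i ∈ Finset.range n, weight H n (i + 1) ^ 2
        + ((H + 1) / (H + n + 1)) ^ 2 := by
    intro n
    rw [Finset.sum_range_succ, Finset.mul_sum]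
    congr 1
    · refine Finset.sum_congr rfl fun i hi => ?_
      have : i < n := Finset.mem_range.1 hi
      rw [weight, if_neg (by omega), one_sub_alpha_succ hH, mul_pow]
    · rw [weight, if_pos rfl, alpha_succ]
  induction n with
  | zero =>
    have : (H + 1) / (H + 1) = 1 := div_self (by linarith)
    rw [hrec]
    simp [this]
    linarith
  | succ n ih =>
    rw [hrec]
    set σ := ∑ i ∈ Finset.range (n + 1), weight H (n + 1) (i + 1) ^ 2
    push_cast
    have hm : (0 : ℝ) ≤ n := n.cast_nonneg
    generalize (n : ℝ) = m at *
    have hd : 0 < H + (m + 1) + 1 := by linarith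
    have h1 : (m + 1 + 1) * (((m + 1) / (H + (m + 1) + 1)) ^ 2 * σ
        + ((H + 1) / (H + (m + 1) + 1)) ^ 2)
        = (m + 2) * ((m + 1) * ((m + 1) * σ) + (H + 1) ^ 2) / (H + (m + 1) + 1) ^ 2 := by
      field_simp
      ring
    rw [h1, div_le_iff₀ (by positivity)]
    have h2 : (m + 2) * ((m + 1) * ((m + 1) * σ) + (H + 1) ^ 2)
        ≤ (m + 2) * ((m + 1) * (2 * H) + (H + 1) ^ 2) := by gcongr
    refine h2.trans ?_
    -- The two sides of the goal differ by exactly `2 * H ^ 3 + (m + 2) * (3 * H ^ 2 - 1)`.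
    have h3 : 0 ≤ (m + 2) * (3 * H ^ 2 - 1) := mul_nonneg (by linarith) (by nlinarith)
    have h4 : 0 ≤ H ^ 3 := by positivity
    nlinarith

lemma sum_sq_weight_le (hH : 1 < H) {n : ℕ} (hn : 1 ≤ n) (m : ℕ) :
    ∑ i ∈ Finset.range m, weight H n (i + 1) ^ 2 ≤ 2 * H / n := by
  obtain ⟨n, rfl⟩ : ∃ k, n = k + 1 := ⟨n - 1, by omega⟩
  have hn' : (0 : ℝ) < (n + 1 : ℕ) := by positivity
  have h1 : ∑ i ∈ Finset.range m, weight H (n + 1) (i + 1) ^ 2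
      ≤ ∑ i ∈ Finset.range (n + 1), weight H (n + 1) (i + 1) ^ 2 := by
    rcases le_total m (n + 1) with h | h
    · exact Finset.sum_le_sum_of_subset_of_nonneg (Finset.range_mono h) fun _ _ _ => sq_nonneg _
    · refine (Finset.sum_subset (Finset.range_mono h) fun i _ hi => ?_).ge
      rw [weight_eq_zero_of_lt (by simpa using hi), sq, mul_zero]
  rw [le_div_iff₀ hn']
  have h2 := sum_sq_weight_le_of_eq hH n
  have h3 := mul_le_mul_of_nonneg_right h1 hn'.le
  push_cast at h3 ⊢
  linarith

end Alpha

/-! ### Running averages of samples sorted by an index -/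

section RunAvg

variable {I : Type*} [DecidableEq I]

/-- The number of times `u < t` with `k u = i`. -/
def visits (k : ℕ → I) : ℕ → I → ℕ
  | 0, _ => 0
  | t + 1, i => if i = k t then visits k t i + 1 else visits k t i

/-- The running averages, for each `i`, of those samples `x u` for which `k u = i`. -/
noncomputable def runAvg (H : ℝ) (k : ℕ → I) (x : ℕ → ℝ) : ℕ → I → ℝ
  | 0, _ => 0
  | t + 1, i => if i = k t then
      (1 - alpha H (visits k t i + 1)) * runAvg H k x t i + alpha H (visits k t i + 1) * x t
    else runAvg H k x t i

variable {H : ℝ} {k : ℕ → I} {x y : ℕ → ℝ}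

lemma visits_succ_self (t : ℕ) : visits k (t + 1) (k t) = visits k t (k t) + 1 := by
  rw [visits, if_pos rfl]

lemma visits_mono (i : I) : Monotone fun t => visits k t i :=
  monotone_nat_of_le_succ fun t => by
    simp only [visits]
    split_ifs <;> omega

lemma visits_le (t : ℕ) (i : I) : visits k t i ≤ t := by
  induction t with
  | zero => exact le_rfl
  | succ t ih =>
    rw [visits]
    split_ifs <;> omega

lemma sum_visits [Fintype I] (t : ℕ) : ∑ i, visits k t i = t := by
  induction t with
  | zero => simp [visits]
  | succ t ih =>
    have : ∀ i, visits k (t + 1) i = visits k t i + if i = k t then 1 else 0 := fun i => by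
      rw [visits]; split_ifs <;> rfl
    simp only [this, Finset.sum_add_distrib, ih, Finset.sum_ite_eq', Finset.mem_univ, if_true]

lemma runAvg_succ_self (t : ℕ) : runAvg H k x (t + 1) (k t)
    = (1 - alpha H (visits k t (k t) + 1)) * runAvg H k x t (k t)
      + alpha H (visits k t (k t) + 1) * x t := by
  rw [runAvg, if_pos rfl]

lemma runAvg_add (t : ℕ) (i : I) :
    runAvg H k (fun u => x u + y u) t i = runAvg H k x t i + runAvg H k y t i := by
  induction t with
  | zero => simp [runAvg]
  | succ t ih =>
    simp only [runAvg]
    split_ifs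
    · rw [ih]; ring
    · exact ih

lemma runAvg_const_mul (c : ℝ) (t : ℕ) (i : I) :
    runAvg H k (fun u => c * x u) t i = c * runAvg H k x t i := by
  induction t with
  | zero => simp [runAvg]
  | succ t ih =>
    simp only [runAvg]
    split_ifs
    · rw [ih]; ring
    · exact ih

lemma runAvg_nonneg (hH : 1 < H) {t : ℕ} (hx : ∀ u < t, 0 ≤ x u) (i : I) :
    0 ≤ runAvg H k x t i := by
  induction t with
  | zero => simp [runAvg]
  | succ t ih =>
    have ih := ih fun u hu => hx u (by omega)
    simp only [runAvg]
    split_ifs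
    · exact add_nonneg (mul_nonneg (one_sub_alpha_succ_nonneg hH _) ih)
        (mul_nonneg (alpha_nonneg hH _) (hx t (by omega)))
    · exact ih

/-- The weights sum to one from the first visit on, because `alpha H 1 = 1` erases the initial
value. -/
lemma runAvg_comp (hH : 1 < H) (c : I → ℝ) (t : ℕ) (i : I) (hi : 1 ≤ visits k t i) :
    runAvg H k (fun u => c (k u)) t i = c i := by
  induction t with
  | zero => simp [visits] at hi
  | succ t ih =>
    rw [visits] at hi
    rw [runAvg]
    split_ifs at hi ⊢ with h
    · rw [← h]
      rcases Nat.eq_zero_or_pos (visits k t i) with h0 | h0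
      · rw [h0, zero_add, alpha_one hH]; ring
      · rw [ih h0]; ring
    · exact ih hi

/-- The total of the running averages at the sampling times. -/
lemma sum_runAvg_add [Fintype I] (hH : 1 < H) (T : ℕ) :
    ∑ t ∈ Finset.range T, runAvg H k x (t + 1) (k t) + ∑ i, visits k T i / H * runAvg H k x T i
      = (1 + 1 / H) * ∑ t ∈ Finset.range T, x t := by
  have hpos : 0 < H := by linarith
  induction T with
  | zero => simp [visits]
  | succ T ih =>
    have hsplit : ∑ i, visits k (T + 1) i / H * runAvg H k x (T + 1) i
        = ∑ i, visits k T i / H * runAvg H k x T i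
          + (visits k (T + 1) (k T) / H * runAvg H k x (T + 1) (k T)
            - visits k T (k T) / H * runAvg H k x T (k T)) := by
      rw [← sub_eq_iff_eq_add', ← Finset.sum_sub_distrib]
      refine Finset.sum_eq_single (k T) (fun i _ hi => ?_) (by simp)
      rw [visits, runAvg, if_neg hi, if_neg hi, sub_self]
    -- With `n` earlier visits, `(1 + (n + 1) / H) * new = n / H * old + (1 + 1 / H) * x T`. The
    -- second sum of the statement is thus a potential recording the weight that the samples have
    -- yet to receive.
    rw [Finset.sum_range_succ, Finset.sum_range_succ, hsplit, mul_add, ← ih, visits_succ_self,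
      runAvg_succ_self, one_sub_alpha_succ hH, alpha_succ]
    have hn : (0 : ℝ) ≤ visits k T (k T) := Nat.cast_nonneg _
    have hd : H + visits k T (k T) + 1 ≠ 0 := by positivity
    push_cast
    field_simp
    ring

/-- For nonnegative samples the final potential can be dropped: over all later averages a sample
counts at most `1 + 1 / H` times. -/
lemma sum_runAvg_le [Fintype I] (hH : 1 < H) {T : ℕ} (hx : ∀ u < T, 0 ≤ x u) :
    ∑ t ∈ Finset.range T, runAvg H k x (t + 1) (k t)
      ≤ (1 + 1 / H) * ∑ t ∈ Finset.range T, x t := by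
  rw [← sum_runAvg_add (k := k) hH]
  refine le_add_of_nonneg_right (Finset.sum_nonneg fun i _ => mul_nonneg ?_ ?_)
  · exact div_nonneg (Nat.cast_nonneg _) (by linarith)
  · exact runAvg_nonneg hH hx i

/-- The running averages of bonuses `c / √τ` lie between `c / √τ` and `2 c / √τ`. -/
lemma runAvg_bonus_mem (hH : 1 < H) {c : ℝ} (hc : 0 ≤ c) (t : ℕ) (i : I)
    (hi : 1 ≤ visits k t i) :
    runAvg H k (fun u => c / √(visits k (u + 1) (k u))) t i
      ∈ Set.Icc (c / √(visits k t i)) (2 * (c / √(visits k t i))) := by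
  induction t with
  | zero => simp [visits] at hi
  | succ t ih =>
    by_cases h : i = k t
    · subst h
      rw [runAvg_succ_self, visits_succ_self]
      set n := visits k t (k t)
      have hn1 : (0 : ℝ) < √((n + 1 : ℕ) : ℝ) := Real.sqrt_pos.2 (by positivity)
      rcases Nat.eq_zero_or_pos n with h0 | h0
      · rw [h0, zero_add, alpha_one hH]
        simp only [Nat.cast_one, Real.sqrt_one, div_one, sub_self, zero_mul, one_mul, zero_add]
        constructor <;> linarith
      · obtain ⟨h1, h2⟩ := ih h0
        have hn : (0 : ℝ) < √(n : ℝ) := Real.sqrt_pos.2 (by positivity)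
        have hα := alpha_nonneg hH (n + 1)
        have hα' := one_sub_alpha_succ_nonneg hH n
        constructor
        · have h3 : c / √((n + 1 : ℕ) : ℝ) ≤ c / √(n : ℝ) := by
            gcongr
            exact Nat.le_succ n
          have h4 := mul_le_mul_of_nonneg_left (h3.trans h1) hα'
          linarith
        · have h4 := mul_le_mul_of_nonneg_left h2 hα'
          refine (add_le_add_left h4 _).trans ?_
          rw [one_sub_alpha_succ hH, alpha_succ]
          have hnn : (0 : ℝ) < n := by exact_mod_cast h0
          have hsq : √(n : ℝ) * √(n : ℝ) = n := Real.mul_self_sqrt hnn.le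
          have hsq1 : √((n + 1 : ℕ) : ℝ) * √((n + 1 : ℕ) : ℝ) = n + 1 := by
            rw [Real.mul_self_sqrt (by positivity)]; push_cast; ring
          have hle : √(n : ℝ) ≤ √((n + 1 : ℕ) : ℝ) := Real.sqrt_le_sqrt (by simp)
          set p := √(n : ℝ)
          set q := √((n + 1 : ℕ) : ℝ)
          have hd : 0 < H + n + 1 := by linarith
          have e1 : (n : ℝ) / (H + n + 1) * (2 * (c / p)) = c / q * (2 * (p * q) / (H + n + 1)) := by
            rw [← hsq]
            field_simp
          have e2 : c / q * (2 * (p * q) / (H + n + 1)) + (H + 1) / (H + n + 1) * (c / q)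
              = c / q * ((2 * (p * q) + (H + 1)) / (H + n + 1)) := by ring
          -- What is left is `2 * p * q + H + 1 ≤ 2 * (H + n + 1)`; it follows from `p * q ≤ q * q =
          -- n + 1` and `1 < H`.
          rw [e1, e2, mul_comm 2 (c / q)]
          refine mul_le_mul_of_nonneg_left ?_ (div_nonneg hc hn1.le)
          rw [div_le_iff₀ hd]
          have : p * q ≤ q * q := mul_le_mul_of_nonneg_right hle hn1.le
          linarith
    · have hv : visits k (t + 1) i = visits k t i := by rw [visits, if_neg h]
      rw [hv] at hi ⊢
      rw [runAvg, if_neg h]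
      exact ih hi

lemma sum_inv_sqrt_visits_le [Fintype I] (T : ℕ) :
    ∑ t ∈ Finset.range T, 1 / √(visits k (t + 1) (k t) : ℝ) ≤ 2 * √(Fintype.card I * T) := by
  have h1 : ∑ t ∈ Finset.range T, 1 / √(visits k (t + 1) (k t) : ℝ)
      ≤ ∑ i, 2 * √(visits k T i : ℝ) := by
    induction T with
    | zero => simp [visits]
    | succ T ih =>
      have hsplit : ∑ i, 2 * √(visits k (T + 1) i : ℝ) = ∑ i, 2 * √(visits k T i : ℝ)
          + (2 * √(visits k (T + 1) (k T) : ℝ) - 2 * √(visits k T (k T) : ℝ)) := by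
        rw [← sub_eq_iff_eq_add', ← Finset.sum_sub_distrib]
        refine Finset.sum_eq_single (k T) (fun i _ hi => ?_) (by simp)
        rw [visits, if_neg hi, sub_self]
      rw [Finset.sum_range_succ, hsplit]
      -- The step is `1 / √(n + 1) ≤ 2 * (√(n + 1) - √n)`. Cauchy–Schwarz, with total visit count
      -- `T`, then finishes the bound.
      refine add_le_add ih ?_
      rw [visits_succ_self]
      set n := visits k T (k T)
      have hq : (0 : ℝ) < √((n + 1 : ℕ) : ℝ) := Real.sqrt_pos.2 (by positivity)
      have hsq : √(n : ℝ) * √(n : ℝ) = n := Real.mul_self_sqrt (Nat.cast_nonneg n)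
      have hsq1 : √((n + 1 : ℕ) : ℝ) * √((n + 1 : ℕ) : ℝ) = n + 1 := by
        rw [Real.mul_self_sqrt (by positivity)]; push_cast; ring
      rw [div_le_iff₀ hq]
      nlinarith [sq_nonneg (√(n : ℝ) - √((n + 1 : ℕ) : ℝ))]
  have h2 : ∑ i, √(visits k T i : ℝ) ≤ √(Fintype.card I * T) := by
    refine Real.le_sqrt_of_sq_le ?_
    refine (sq_sum_le_card_mul_sum_sq (s := Finset.univ)).trans ?_
    simp only [Real.sq_sqrt (Nat.cast_nonneg _), Finset.card_univ]
    rw [← Nat.cast_sum, sum_visits]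
  rw [← Finset.mul_sum] at h1
  linarith

/-- The recursion is unrolled. The sum may run up to `T`, since samples after time `t` have an index
beyond the visit count and hence weight zero; so the time `t` enters only through that count. -/
lemma runAvg_eq_sum_weight (t : ℕ) (i : I) {T : ℕ} (hT : t ≤ T) :
    runAvg H k x t i = ∑ u ∈ Finset.range T,
      if k u = i then weight H (visits k t i) (visits k (u + 1) i) * x u else 0 := by
  have hsub : ∑ u ∈ Finset.range T,
      (if k u = i then weight H (visits k t i) (visits k (u + 1) i) * x u else 0)
      = ∑ u ∈ Finset.range t,
      (if k u = i then weight H (visits k t i) (visits k (u + 1) i) * x u else 0) := by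
    refine (Finset.sum_subset (Finset.range_mono hT) fun u _ hu => ?_).symm
    split_ifs with h
    · have h1 : visits k t i ≤ visits k u i := visits_mono i (by simpa using hu)
      have h2 : visits k (u + 1) i = visits k u i + 1 := by rw [← h, visits_succ_self]
      rw [weight_eq_zero_of_lt (by omega), zero_mul]
    · rfl
  rw [hsub]
  clear hsub hT
  induction t with
  | zero => simp [runAvg]
  | succ t ih =>
    rw [Finset.sum_range_succ]
    by_cases h : i = k t
    · subst h
      rw [runAvg_succ_self, if_pos rfl, ih, visits_succ_self, Finset.mul_sum, weight, if_pos rfl]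
      congr 1
      refine Finset.sum_congr rfl fun u hu => ?_
      split_ifs
      · have h1 : visits k (u + 1) (k t) ≤ visits k t (k t) :=
          visits_mono _ (by have := Finset.mem_range.1 hu; omega)
        rw [weight, if_neg (by omega)]
        ring
      · rw [mul_zero]
    · have hv : visits k (t + 1) i = visits k t i := by rw [visits, if_neg h]
      rw [runAvg, if_neg h, if_neg (Ne.symm h), add_zero, hv, ih]

/-- Successive visits to `i` carry the indices `1, 2, …`, each once, so the bound holds for every
path `k`. The variance sum is therefore bounded surely, although the visit times are random. -/
lemma sum_sq_weight_visits_le (hH : 1 < H) {n : ℕ} (hn : 1 ≤ n) (i : I) (T : ℕ) :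
    ∑ u ∈ Finset.range T, (if k u = i then weight H n (visits k (u + 1) i) ^ 2 else 0)
      ≤ 2 * H / n := by
  have : ∑ u ∈ Finset.range T, (if k u = i then weight H n (visits k (u + 1) i) ^ 2 else 0)
      = ∑ j ∈ Finset.range (visits k T i), weight H n (j + 1) ^ 2 := by
    induction T with
    | zero => simp [visits]
    | succ T ih =>
      rw [Finset.sum_range_succ, ih]
      by_cases h : i = k T
      · subst h
        rw [if_pos rfl, visits_succ_self, Finset.sum_range_succ]
      · have hv : visits k (T + 1) i = visits k T i := by rw [visits, if_neg h]
        rw [if_neg (Ne.symm h), hv, add_zero]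
  rw [this]
  exact sum_sq_weight_le hH hn _

end RunAvg

end DONQ

/-! ### DONQ-learning along a trajectory -/

namespace DONQ

/-! ### Invariants of the iterates -/

section Regular

variable {S A B : Type*} [Fintype A] [Fintype B]

/-- The bounds and the equilibrium property that all iterates of DONQ-learning satisfy. -/
structure IsRegular (H : ℝ) (x : DONQState S A B) : Prop where
  Q_nonneg : ∀ u v w, 0 ≤ x.Q u v w
  Qdown_nonneg : ∀ u v w, 0 ≤ x.Qdown u v w
  Qdown_le : ∀ u v w, x.Qdown u v w ≤ H
  nash : ∀ u, ∃ q, IsMatrixNash (x.Qdown u) (x.pol u) q ∧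
    x.Vdown u = mixedPayoff (x.Qdown u) (x.pol u) q

namespace IsRegular

variable {H : ℝ} {x y : DONQState S A B}

lemma Vdown_mem (h : IsRegular H x) (u : S) : x.Vdown u ∈ Set.Icc 0 H := by
  obtain ⟨q, -, hq⟩ := h.nash u
  rw [hq]
  exact ⟨(mixedPayoff_const (A := A) (B := B) 0 (x.pol u) q).symm.trans_le
      (mixedPayoff_mono (h.Qdown_nonneg u) _ _),
    (mixedPayoff_mono (h.Qdown_le u) _ _).trans_eq (mixedPayoff_const H _ _)⟩

/-- An equilibrium strategy secures the value against every pure reply; this is how the policy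
protects against an arbitrary opponent. -/
lemma Vdown_le_sum [DecidableEq B] (h : IsRegular H x) (u : S) (w : B) :
    x.Vdown u ≤ ∑ v, x.pol u v * x.Qdown u v w := by
  obtain ⟨q, hn, hq⟩ := h.nash u
  rw [hq]
  exact hn.payoff_le_sum w

lemma Vdown_mono (hx : IsRegular H x) (hy : IsRegular H y) {u : S}
    (h : ∀ v w, x.Qdown u v w ≤ y.Qdown u v w) : x.Vdown u ≤ y.Vdown u := by
  obtain ⟨q, hn, hq⟩ := hx.nash u
  obtain ⟨q', hn', hq'⟩ := hy.nash u
  rw [hq, hq']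
  exact hn.payoff_mono hn' h

lemma le_Vdown [Fintype S] [Nonempty A] [Nonempty B] {G : StochasticGame S A B} {V : S → ℝ} (hV : G.IsDiscountedValue H V)
    (hx : IsRegular H x) {u : S} (h : ∀ v w, G.lookahead H V u v w ≤ x.Qdown u v w) :
    V u ≤ x.Vdown u := by
  obtain ⟨q, hn, hq⟩ := hx.nash u
  rw [hq, hV u]
  exact (isMatrixNash_opt _).payoff_mono hn h

end IsRegular

end Regular

/-- The state-action triples of a trajectory. -/
def triples {S A B : Type*} (s : ℕ → S) (a : ℕ → A) (b : ℕ → B) (t : ℕ) : S × A × B := (s t, a t, b t)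

lemma eq_triples_iff {S A B : Type*} {s : ℕ → S} {a : ℕ → A} {b : ℕ → B} {t : ℕ} {u : S} {v : A} {w : B} :
    (u, v, w) = triples s a b t ↔ u = s t ∧ v = a t ∧ w = b t := by
  simp [triples]

/-- The deviation of `V` at the next state from its expectation. -/
def noise {S A B : Type*} [Fintype S] (G : StochasticGame S A B) (V : S → ℝ) (s : ℕ → S) (a : ℕ → A) (b : ℕ → B) (t : ℕ) : ℝ :=
  V (s (t + 1)) - G.nextValue V (s t) (a t) (b t)

section Noise

variable {S A B : Type*} [Fintype S] [DecidableEq S] [DecidableEq A] [DecidableEq B]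
  {G : StochasticGame S A B} {D H δ : ℝ} {T : ℕ} {s : ℕ → S} {a : ℕ → A} {b : ℕ → B}

/-- The averaged noise is dominated by the bonuses, at all triples and all sample sizes. -/
def NoiseBounded (G : StochasticGame S A B) (V : S → ℝ) (D H δ : ℝ) (T : ℕ)
    (s : ℕ → S) (a : ℕ → A) (b : ℕ → B) : Prop :=
  ∀ (i : S × A × B) (n : ℕ), 1 ≤ n → n ≤ T →
    |∑ u ∈ Finset.range T, if triples s a b u = i then
      weight H n (visits (triples s a b) (u + 1) i) * noise G V s a b u else 0| ≤ beta D H δ T n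

/-- The visit count depends on the path, but it is one of `1, …, T`. Fixing the sample size `n` in
`NoiseBounded` is what allows concentration with deterministic coefficients `weight H n` and a union
bound over `n`. -/
lemma NoiseBounded.abs_runAvg_le {V : S → ℝ} (h : NoiseBounded G V D H δ T s a b) {t : ℕ}
    (ht : t ≤ T) (i : S × A × B) (hi : 1 ≤ visits (triples s a b) t i) :
    |runAvg H (triples s a b) (noise G V s a b) t i|
      ≤ beta D H δ T (visits (triples s a b) t i) := by
  rw [runAvg_eq_sum_weight t i ht]
  exact h i _ hi ((visits_le t i).trans ht)

end Noise

/-! ### Optimism and the regret on a fixed trajectory -/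

section Trajectory

variable {S A B : Type*} [Fintype S] [Fintype A] [Fintype B]
  [DecidableEq S] [DecidableEq A] [DecidableEq B] [Nonempty A]

variable {G : StochasticGame S A B} {nash : (A → B → ℝ) → stdSimplex ℝ A × stdSimplex ℝ B}
  {D H δ : ℝ} {T : ℕ} {s : ℕ → S} {a : ℕ → A} {b : ℕ → B}

lemma beta_nonneg (hD : 0 ≤ D) (n : ℕ) : 0 ≤ beta D H δ T n := by
  rw [beta]; positivity

lemma beta_eq (n : ℕ) :
    beta D H δ T n = 2 * D * √(H * Real.log (2 * T / δ)) / √(n : ℝ) := by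
  rw [beta, Real.sqrt_div' _ (Nat.cast_nonneg n)]
  exact (mul_div_assoc _ _ _).symm

lemma state_N (t : ℕ) (u : S) (v : A) (w : B) :
    (state G nash D H δ T s a b t).N u v w = visits (triples s a b) t (u, v, w) := by
  induction t generalizing u v w with
  | zero => rfl
  | succ t ih =>
    simp only [state, step, visits, eq_triples_iff]
    split_ifs with h
    · obtain ⟨rfl, rfl, rfl⟩ := h
      rw [ih]
    · exact ih u v w

lemma state_Q_succ (t : ℕ) (u : S) (v : A) (w : B) :
    (state G nash D H δ T s a b (t + 1)).Q u v w = if (u, v, w) = triples s a b t then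
      (1 - alpha H (visits (triples s a b) t (u, v, w) + 1))
        * (state G nash D H δ T s a b t).Q u v w
      + alpha H (visits (triples s a b) t (u, v, w) + 1) * (G.r (s t) (a t) (b t)
        + (1 - 1 / H) * (state G nash D H δ T s a b t).Vdown (s (t + 1))
        + beta D H δ T (visits (triples s a b) t (u, v, w) + 1))
    else (state G nash D H δ T s a b t).Q u v w := by
  simp only [state, step, eq_triples_iff]
  split_ifs with h
  · obtain ⟨rfl, rfl, rfl⟩ := h
    rw [state_N]
  · rfl

lemma state_Qdown_succ (t : ℕ) (u : S) (v : A) (w : B) :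
    (state G nash D H δ T s a b (t + 1)).Qdown u v w = if (u, v, w) = triples s a b t then
      min ((state G nash D H δ T s a b t).Qdown u v w)
        ((state G nash D H δ T s a b (t + 1)).Q u v w)
    else (state G nash D H δ T s a b t).Qdown u v w := by
  simp only [state, step, eq_triples_iff]
  split_ifs with h
  · obtain ⟨rfl, rfl, rfl⟩ := h
    rfl
  · rfl

lemma state_Qdown_succ_le (t : ℕ) (u : S) (v : A) (w : B) :
    (state G nash D H δ T s a b (t + 1)).Qdown u v w
      ≤ (state G nash D H δ T s a b t).Qdown u v w := by
  rw [state_Qdown_succ]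
  split_ifs
  · exact min_le_left _ _
  · exact le_rfl

/-- `state.Q` is a running average of the targets. -/
lemma state_Q_eq_runAvg (hH : 1 < H) (t : ℕ) (u : S) (v : A) (w : B)
    (hi : 1 ≤ visits (triples s a b) t (u, v, w)) :
    (state G nash D H δ T s a b t).Q u v w = runAvg H (triples s a b) (fun i =>
      G.r (s i) (a i) (b i) + (1 - 1 / H) * (state G nash D H δ T s a b i).Vdown (s (i + 1))
        + beta D H δ T (visits (triples s a b) (i + 1) (triples s a b i))) t (u, v, w) := by
  induction t with
  | zero => simp [visits] at hi
  | succ t ih =>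
    rw [visits] at hi
    rw [state_Q_succ, runAvg, visits_succ_self]
    split_ifs at hi ⊢ with h
    · rw [← h]
      -- At the first visit the learning rate is one, which erases the different initial values: `H`
      -- for `Q`, zero for `runAvg`.
      rcases Nat.eq_zero_or_pos (visits (triples s a b) t (u, v, w)) with h0 | h0
      · rw [h0, zero_add, alpha_one hH]; ring
      · rw [ih h0]
    · exact ih hi

/-- The error of `state.Q` splits into the averaged errors of `Vdown`, noise, and bonuses. -/
lemma state_Q_sub_lookahead (hH : 1 < H) (V : S → ℝ) (t : ℕ) (u : S) (v : A) (w : B)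
    (hi : 1 ≤ visits (triples s a b) t (u, v, w)) :
    (state G nash D H δ T s a b t).Q u v w - G.lookahead H V u v w
      = (1 - 1 / H) * runAvg H (triples s a b) (fun i =>
          (state G nash D H δ T s a b i).Vdown (s (i + 1)) - V (s (i + 1))) t (u, v, w)
        + (1 - 1 / H) * runAvg H (triples s a b) (noise G V s a b) t (u, v, w)
        + runAvg H (triples s a b) (fun i =>
          2 * D * √(H * Real.log (2 * T / δ)) / √(visits (triples s a b) (i + 1)
            (triples s a b i))) t (u, v, w) := by
  rw [state_Q_eq_runAvg hH t u v w hi, sub_eq_iff_eq_add,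
    ← runAvg_comp hH (fun j : S × A × B => G.lookahead H V j.1 j.2.1 j.2.2) t (u, v, w) hi,
    ← runAvg_const_mul, ← runAvg_const_mul, ← runAvg_add, ← runAvg_add, ← runAvg_add]
  congr 1
  ext i
  simp only [noise, StochasticGame.lookahead, triples, beta_eq]
  ring

variable [Nonempty B]

lemma isRegular_state (hnash : IsNashSolver nash) (hD : 0 ≤ D) (hH : 1 < H) (t : ℕ) :
    IsRegular H (state G nash D H δ T s a b t) := by
  induction t with
  | zero =>
    have h0 : 0 ≤ H := by linarith
    -- The initial matrix is constant, so every pair of mixed actions is an equilibrium of it.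
    refine ⟨fun _ _ _ => h0, fun _ _ _ => h0, fun _ _ _ => le_rfl, fun u =>
      ⟨Classical.arbitrary _, ⟨fun p' => ?_, fun q' => ?_⟩, ?_⟩⟩ <;>
    simp [state, init]
  | succ t ih =>
    have hQ : ∀ u v w, 0 ≤ (state G nash D H δ T s a b (t + 1)).Q u v w := by
      intro u v w
      rw [state_Q_succ]
      split_ifs
      · refine add_nonneg (mul_nonneg (one_sub_alpha_succ_nonneg hH _) (ih.Q_nonneg u v w))
          (mul_nonneg (alpha_nonneg hH _) (add_nonneg (add_nonneg (G.r_mem _ _ _).1 ?_)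
            (beta_nonneg hD _)))
        exact mul_nonneg (StochasticGame.discount_nonneg hH) (ih.Vdown_mem _).1
      · exact ih.Q_nonneg u v w
    refine ⟨hQ, fun u v w => ?_, fun u v w => ?_, fun u => ?_⟩
    · rw [state_Qdown_succ]
      split_ifs
      · exact le_min (ih.Qdown_nonneg u v w) (hQ u v w)
      · exact ih.Qdown_nonneg u v w
    · rw [state_Qdown_succ]
      split_ifs
      · exact (min_le_left _ _).trans (ih.Qdown_le u v w)
      · exact ih.Qdown_le u v w
    · by_cases h : u = s t
      · subst h
        refine ⟨(nash ((state G nash D H δ T s a b (t + 1)).Qdown (s t))).2, ?_, ?_⟩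
        · have hpol : (state G nash D H δ T s a b (t + 1)).pol (s t)
              = (nash ((state G nash D H δ T s a b (t + 1)).Qdown (s t))).1 := by
            simp [state, step]
          rw [hpol]
          exact hnash _
        · simp [state, step]
      · obtain ⟨q, hn, hq⟩ := ih.nash u
        refine ⟨q, ?_⟩
        have h1 : (state G nash D H δ T s a b (t + 1)).Qdown u
            = (state G nash D H δ T s a b t).Qdown u := by
          ext v w
          rw [state_Qdown_succ, if_neg (by simp [triples, h])]
        have h2 : (state G nash D H δ T s a b (t + 1)).pol u
            = (state G nash D H δ T s a b t).pol u := by simp [state, step, h]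
        have h3 : (state G nash D H δ T s a b (t + 1)).Vdown u
            = (state G nash D H δ T s a b t).Vdown u := by simp [state, step, h]
        rw [h1, h2, h3]
        exact ⟨hn, hq⟩

lemma state_Vdown_succ_le (hnash : IsNashSolver nash) (hD : 0 ≤ D) (hH : 1 < H) (t : ℕ) (u : S) :
    (state G nash D H δ T s a b (t + 1)).Vdown u ≤ (state G nash D H δ T s a b t).Vdown u :=
  (isRegular_state hnash hD hH (t + 1)).Vdown_mono (isRegular_state hnash hD hH t)
    fun v w => state_Qdown_succ_le t u v w

/-- The estimates of DONQ-learning are optimistic. -/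
lemma optimism (hnash : IsNashSolver nash) (hD : 0 ≤ D) (hH : 1 < H) {V : S → ℝ}
    (hV : G.IsDiscountedValue H V) (hN : NoiseBounded G V D H δ T s a b) {t : ℕ} (ht : t ≤ T) :
    (∀ u v w, G.lookahead H V u v w ≤ (state G nash D H δ T s a b t).Qdown u v w) ∧
      ∀ u, V u ≤ (state G nash D H δ T s a b t).Vdown u := by
  induction t using Nat.strong_induction_on with
  -- The induction is strong because `Q` averages the errors of `Vdown` at all earlier visits. These
  -- are nonnegative, and the averaged bonus, at least `beta`, outweighs the averaged noise.
  | _ t ih =>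
    have hγ := StochasticGame.discount_nonneg hH
    suffices hQ : ∀ u v w,
        G.lookahead H V u v w ≤ (state G nash D H δ T s a b t).Qdown u v w from
      ⟨hQ, fun u => (isRegular_state hnash hD hH t).le_Vdown hV (hQ u)⟩
    intro u v w
    rcases t with - | t
    · have h1 : G.lookahead H V u v w ≤ 1 + (1 - 1 / H) * H :=
        add_le_add (G.r_mem u v w).2 (mul_le_mul_of_nonneg_left
          (StochasticGame.nextValue_le (hV.le_horizon hH) u v w) hγ)
      have h2 : 1 + (1 - 1 / H) * H = H := by
        have : H ≠ 0 := by linarith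
        field_simp
        ring
      exact h1.trans h2.le
    · rw [state_Qdown_succ]
      split_ifs with h
      · refine le_min ((ih t (by omega) (by omega)).1 u v w) ?_
        have hi : 1 ≤ visits (triples s a b) (t + 1) (u, v, w) := by
          rw [h, visits_succ_self]; omega
        have h1 := state_Q_sub_lookahead (G := G) (nash := nash) (D := D) (δ := δ) (T := T)
          hH V (t + 1) u v w hi
        have h2 : 0 ≤ runAvg H (triples s a b) (fun i =>
            (state G nash D H δ T s a b i).Vdown (s (i + 1)) - V (s (i + 1))) (t + 1)
            (u, v, w) :=
          runAvg_nonneg hH (fun i hi => sub_nonneg.2 ((ih i hi (by omega)).2 _)) _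
        have h3 := (abs_le.1 (hN.abs_runAvg_le ht (u, v, w) hi)).1
        have h4 := (runAvg_bonus_mem (k := triples s a b) hH
          (c := 2 * D * √(H * Real.log (2 * T / δ))) (by positivity) (t + 1) (u, v, w) hi).1
        have h5 := beta_nonneg (H := H) (δ := δ) (T := T) hD
          (visits (triples s a b) (t + 1) (u, v, w))
        rw [← beta_eq] at h4
        have h6 := mul_nonneg hγ h2
        have h7 := mul_le_mul_of_nonneg_left h3 hγ
        have h8 : 1 - 1 / H ≤ 1 := by
          have : 0 < 1 / H := by positivity
          linarith
        have h9 := mul_le_mul_of_nonneg_right h8 h5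
        linarith
      · exact (ih t (by omega) (by omega)).1 u v w

/-- A telescoping bound for a decreasing sequence of functions, evaluated along a path. -/
lemma sum_sub_succ_le {I : Type*} [Fintype I] {f : ℕ → I → ℝ} {c : ℝ} (k : ℕ → I) (T : ℕ)
    (hf : ∀ t i, f (t + 1) i ≤ f t i) (h0 : ∀ i, f 0 i ≤ c) (hT : ∀ i, 0 ≤ f T i) :
    ∑ t ∈ Finset.range T, (f t (k t) - f (t + 1) (k t)) ≤ Fintype.card I * c :=
  calc ∑ t ∈ Finset.range T, (f t (k t) - f (t + 1) (k t))
      ≤ ∑ t ∈ Finset.range T, ∑ i, (f t i - f (t + 1) i) := Finset.sum_le_sum fun t _ =>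
        Finset.single_le_sum (f := fun i => f t i - f (t + 1) i)
          (fun i _ => sub_nonneg.2 (hf t i)) (Finset.mem_univ (k t))
    _ = ∑ i, (f 0 i - f T i) := by
        rw [Finset.sum_comm]
        exact Finset.sum_congr rfl fun i _ => Finset.sum_range_sub' (fun t => f t i) T
    _ ≤ ∑ _i : I, c := Finset.sum_le_sum fun i _ => by linarith [h0 i, hT i]
    _ = Fintype.card I * c := by simp

/-- The regret bound on trajectories with controlled noise. -/
theorem regret_le_of_noiseBounded [Nonempty S] (hnash : IsNashSolver nash) (hD : 0 ≤ D) (hH : 1 < H)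
    {V : S → ℝ} (hV : G.IsDiscountedValue H V) {J : ℝ} (hJ : ∀ u, J ≤ (V u + D) / H)
    (hN : NoiseBounded G V D H δ T s a b) :
    regret G J T s a b ≤ D * T / H
      + ∑ t ∈ Finset.range T, ((state G nash D H δ T s a b t).Vdown (s t)
          - (state G nash D H δ T s a b t).Qdown (s t) (a t) (b t))
      + 12 * D * √(Fintype.card S * Fintype.card A * Fintype.card B * H * T
          * Real.log (2 * T / δ))
      + 2 * (Fintype.card S * Fintype.card A * Fintype.card B * H)
      + ∑ t ∈ Finset.range T, -noise G V s a b t := by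
  have hpos : 0 < H := by linarith
  have hγ := StochasticGame.discount_nonneg hH
  set k := triples s a b with hk
  set x := state G nash D H δ T s a b with hx
  set c := 2 * D * √(H * Real.log (2 * T / δ)) with hc
  have hc0 : 0 ≤ c := by positivity
  have hreg : ∀ t, IsRegular H (x t) := isRegular_state hnash hD hH
  have hQdown : ∑ t ∈ Finset.range T,
      ((x t).Qdown (s t) (a t) (b t) - (x (t + 1)).Qdown (s t) (a t) (b t))
      ≤ Fintype.card (S × A × B) * H :=
    sum_sub_succ_le (f := fun t (i : S × A × B) => (x t).Qdown i.1 i.2.1 i.2.2) k T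
      (fun t i => state_Qdown_succ_le t _ _ _) (fun i => (hreg 0).Qdown_le _ _ _)
      (fun i => (hreg T).Qdown_nonneg _ _ _)
  have hVdown : ∑ t ∈ Finset.range T, ((x t).Vdown (s (t + 1)) - (x (t + 1)).Vdown (s (t + 1)))
      ≤ Fintype.card S * H :=
    sum_sub_succ_le (f := fun t u => (x t).Vdown u) (fun t => s (t + 1)) T
      (fun t u => state_Vdown_succ_le hnash hD hH t u) (fun u => ((hreg 0).Vdown_mem u).2)
      (fun u => ((hreg T).Vdown_mem u).1)
  -- `Vdown` starts at its maximal value `H`, so the telescoped sum costs nothing.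
  have htel : ∑ t ∈ Finset.range T, ((x (t + 1)).Vdown (s (t + 1)) - (x t).Vdown (s t)) ≤ 0 := by
    rw [Finset.sum_range_sub (fun t => (x t).Vdown (s t))]
    exact sub_nonpos.2 ((hreg T).Vdown_mem _).2
  have hbonus : ∑ t ∈ Finset.range T, c / √(visits k (t + 1) (k t) : ℝ)
      ≤ 4 * D * √(Fintype.card S * Fintype.card A * Fintype.card B * H * T
        * Real.log (2 * T / δ)) := by
    have h1 := mul_le_mul_of_nonneg_left (sum_inv_sqrt_visits_le (k := k) T) hc0
    rw [Finset.mul_sum] at h1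
    simp only [mul_one_div] at h1
    refine h1.trans_eq ?_
    have h2 : (Fintype.card S * Fintype.card A * Fintype.card B * H * T
        * Real.log (2 * T / δ) : ℝ)
        = H * Real.log (2 * T / δ) * (Fintype.card (S × A × B) * T) := by
      simp only [Fintype.card_prod]; push_cast; ring
    rw [h2, Real.sqrt_mul' _ (by positivity : (0 : ℝ) ≤ Fintype.card (S × A × B) * T), hc]
    ring
  have herr : ∑ t ∈ Finset.range T, runAvg H k (fun i => (x i).Vdown (s (i + 1)) - V (s (i + 1)))
      (t + 1) (k t) ≤ (1 + 1 / H) * ∑ t ∈ Finset.range T,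
        ((x t).Vdown (s (t + 1)) - V (s (t + 1))) :=
    sum_runAvg_le hH fun u hu => sub_nonneg.2 ((optimism hnash hD hH hV hN hu.le).2 _)
  have herr0 : 0 ≤ ∑ t ∈ Finset.range T, ((x t).Vdown (s (t + 1)) - V (s (t + 1))) :=
    Finset.sum_nonneg fun u hu => sub_nonneg.2
      ((optimism hnash hD hH hV hN (Finset.mem_range.1 hu).le).2 _)
  have herr1 : (1 - 1 / H) * ∑ t ∈ Finset.range T, runAvg H k
      (fun i => (x i).Vdown (s (i + 1)) - V (s (i + 1))) (t + 1) (k t)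
      ≤ ∑ t ∈ Finset.range T, ((x t).Vdown (s (t + 1)) - V (s (t + 1))) := by
    refine (mul_le_mul_of_nonneg_left herr hγ).trans ?_
    rw [← mul_assoc]
    refine mul_le_of_le_one_left herr0 ?_
    have : (1 - 1 / H) * (1 + 1 / H) = 1 - (1 / H) ^ 2 := by ring
    rw [this]
    linarith [sq_nonneg (1 / H)]
  -- Here `Qdown ≤ Q` after the update, and `Q` minus the lookahead of `V` is split into its three
  -- averages. Noise contributes one bonus and averaged bonuses two, hence the factor 3. The next
  -- value of `V` is written as `Vdown` minus its error minus noise, and `Vdown` is moved from `s (t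
  -- + 1)` back to `s t`.
  have hstep : ∀ t ∈ Finset.range T, J - G.r (s t) (a t) (b t) ≤
      D / H + ((x t).Vdown (s t) - (x t).Qdown (s t) (a t) (b t))
        + ((x t).Qdown (s t) (a t) (b t) - (x (t + 1)).Qdown (s t) (a t) (b t))
        + 3 * (c / √(visits k (t + 1) (k t) : ℝ))
        + (1 - 1 / H) * runAvg H k (fun i => (x i).Vdown (s (i + 1)) - V (s (i + 1)))
            (t + 1) (k t)
        - ((x t).Vdown (s (t + 1)) - V (s (t + 1)))
        + ((x t).Vdown (s (t + 1)) - (x (t + 1)).Vdown (s (t + 1)))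
        + ((x (t + 1)).Vdown (s (t + 1)) - (x t).Vdown (s t))
        + -noise G V s a b t := by
    intro t ht
    have ht' : t + 1 ≤ T := Finset.mem_range.1 ht
    have hi : 1 ≤ visits k (t + 1) (k t) := by rw [visits_succ_self]; omega
    have h1 : (x (t + 1)).Qdown (s t) (a t) (b t) ≤ (x (t + 1)).Q (s t) (a t) (b t) := by
      rw [hx, state_Qdown_succ, if_pos (eq_triples_iff.2 ⟨rfl, rfl, rfl⟩)]
      exact min_le_right _ _
    have h2 := state_Q_sub_lookahead (G := G) (nash := nash) (D := D) (δ := δ) (T := T)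
      hH V (t + 1) (s t) (a t) (b t) hi
    have h3 := (abs_le.1 (hN.abs_runAvg_le ht' (k t) hi)).2
    have h4 := (runAvg_bonus_mem hH hc0 (t + 1) (k t) hi).2
    have h5 : (H * J - D) / H ≤ G.nextValue V (s t) (a t) (b t) / H := by
      refine div_le_div_of_nonneg_right (StochasticGame.le_nextValue (fun z => ?_) _ _ _) hpos.le
      have := hJ z
      rw [le_div_iff₀ hpos] at this
      linarith
    have h6 : (H * J - D) / H = J - D / H := by field_simp
    have h7 : G.lookahead H V (s t) (a t) (b t) = G.r (s t) (a t) (b t)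
        + G.nextValue V (s t) (a t) (b t) - G.nextValue V (s t) (a t) (b t) / H := by
      rw [StochasticGame.lookahead]; ring
    rw [beta_eq] at h3
    have h8 := mul_le_mul_of_nonneg_left h3 hγ
    have h9 : (1 - 1 / H) * (c / √(visits k (t + 1) (k t) : ℝ))
        ≤ c / √(visits k (t + 1) (k t) : ℝ) := by
      refine mul_le_of_le_one_left (by positivity) ?_
      have : 0 < 1 / H := by positivity
      linarith
    change (x (t + 1)).Q (s t) (a t) (b t) - G.lookahead H V (s t) (a t) (b t)
      = (1 - 1 / H) * runAvg H k _ (t + 1) (k t) + (1 - 1 / H) * runAvg H k _ (t + 1) (k t)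
        + runAvg H k (fun i => c / √(visits k (i + 1) (k i) : ℝ)) (t + 1) (k t) at h2
    simp only [noise] at *
    linarith
  have hsum := Finset.sum_le_sum hstep
  simp only [Finset.sum_add_distrib, Finset.sum_sub_distrib (G := ℝ), ← Finset.mul_sum] at *
  simp only [regret, Finset.sum_sub_distrib (G := ℝ)]
  have hDT : ∑ t ∈ Finset.range T, D / H = D * T / H := by
    rw [Finset.sum_const, Finset.card_range, nsmul_eq_mul]; ring
  have hcard : (Fintype.card (S × A × B) : ℝ) * H
      = Fintype.card S * Fintype.card A * Fintype.card B * H := by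
    simp only [Fintype.card_prod]; push_cast; ring
  -- The decreases of `Qdown` and of `Vdown` each cost at most `S A B H`, hence the factor 2 in the
  -- bound.
  have hcardS : (Fintype.card S : ℝ) * H
      ≤ Fintype.card S * Fintype.card A * Fintype.card B * H := by
    have h1 : (1 : ℝ) ≤ Fintype.card A := by exact_mod_cast Fintype.card_pos
    have h2 : (1 : ℝ) ≤ Fintype.card B := by exact_mod_cast Fintype.card_pos
    have h3 : (1 : ℝ) ≤ Fintype.card A * Fintype.card B := one_le_mul_of_one_le_of_one_le h1 h2
    rw [mul_assoc (Fintype.card S : ℝ)]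
    exact mul_le_mul_of_nonneg_right (le_mul_of_one_le_right (Nat.cast_nonneg _) h3) hpos.le
  rw [hDT] at hsum
  rw [hcard] at hQdown
  linarith

end Trajectory

end DONQ

/-! ### Concentration along a play -/

/-- **Hoeffding's lemma** for finite distributions. -/
lemma stdSimplex.sum_mul_exp_le {ι : Type*} [Fintype ι] (p : stdSimplex ℝ ι) {f : ι → ℝ} {l u : ℝ}
    (hf : ∀ i, f i ∈ Set.Icc l u) (c : ℝ) :
    ∑ i, p i * Real.exp (c * (f i - ∑ j, p j * f j)) ≤ Real.exp (c ^ 2 * (u - l) ^ 2 / 8) := by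
  let _ : MeasurableSpace ι := ⊤
  have hsum : ∑ i, ENNReal.ofReal (p i) = 1 := by
    rw [← ENNReal.ofReal_sum_of_nonneg fun i _ => stdSimplex.zero_le p i, stdSimplex.sum_eq_one,
      ENNReal.ofReal_one]
  let P : PMF ι := PMF.ofFintype (fun i => ENNReal.ofReal (p i)) hsum
  have hint : ∀ g : ι → ℝ, ∫ i, g i ∂P.toMeasure = ∑ i, p i * g i := fun g => by
    rw [PMF.integral_eq_sum]
    refine Finset.sum_congr rfl fun i _ => ?_
    rw [PMF.ofFintype_apply, ENNReal.toReal_ofReal (stdSimplex.zero_le p i), smul_eq_mul]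
  have h := (ProbabilityTheory.hasSubgaussianMGF_of_mem_Icc (μ := P.toMeasure) (X := f) (a := l)
    (b := u) (measurable_from_top).aemeasurable (Eventually.of_forall hf)).mgf_le c
  rw [ProbabilityTheory.mgf, hint, hint] at h
  refine h.trans_eq ?_
  congr 1
  push_cast
  rw [Real.norm_eq_abs, div_pow, sq_abs]
  ring

namespace DONQ

section Play

variable {S A B : Type*} [Fintype S] [Fintype A] [Fintype B]
  [DecidableEq S] [DecidableEq A] [DecidableEq B] [Nonempty A]
  {G : StochasticGame S A B} {nash : (A → B → ℝ) → stdSimplex ℝ A × stdSimplex ℝ B}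
  {D H δ : ℝ} {T : ℕ} {Ω : Type*} {m : MeasurableSpace Ω} {ℙ : Measure Ω}
  {ℱ : Filtration ℕ m} {s : ℕ → Ω → S} {a : ℕ → Ω → A} {b : ℕ → Ω → B}
  {ν : ℕ → Ω → stdSimplex ℝ B}

/-- The variables of DONQ-learning as random variables. -/
noncomputable def randState (G : StochasticGame S A B)
    (nash : (A → B → ℝ) → stdSimplex ℝ A × stdSimplex ℝ B) (D H δ : ℝ) (T : ℕ)
    (s : ℕ → Ω → S) (a : ℕ → Ω → A) (b : ℕ → Ω → B) (t : ℕ) (ω : Ω) : DONQState S A B :=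
  state G nash D H δ T (fun i => s i ω) (fun i => a i ω) (fun i => b i ω) t

/-- A quantity that depends on the variables of the algorithm and on one transition, along a
play. -/
noncomputable def along (G : StochasticGame S A B)
    (nash : (A → B → ℝ) → stdSimplex ℝ A × stdSimplex ℝ B) (D H δ : ℝ) (T : ℕ)
    (s : ℕ → Ω → S) (a : ℕ → Ω → A) (b : ℕ → Ω → B)
    (f : DONQState S A B → S → A → B → S → ℝ) (t : ℕ) (ω : Ω) : ℝ :=
  f (randState G nash D H δ T s a b t ω) (s t ω) (a t ω) (b t ω) (s (t + 1) ω)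

/-- A function of two variables is measurable if the first is discretely measurable and the second
takes finitely many values. -/
lemma measurableSet_setOf_mem_comp {Ω α β : Type*} [Finite β] {m : MeasurableSpace Ω} {X : Ω → α}
    {Y : Ω → β} (hX : ∀ U : Set α, MeasurableSet {ω | X ω ∈ U})
    (hY : ∀ y, MeasurableSet {ω | Y ω = y}) {γ : Type*} (φ : α → β → γ) (U : Set γ) :
    MeasurableSet {ω | φ (X ω) (Y ω) ∈ U} := by
  have : {ω | φ (X ω) (Y ω) ∈ U} = ⋃ y, {ω | Y ω = y} ∩ {ω | X ω ∈ {x | φ x y ∈ U}} := by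
    ext ω; simp
  rw [this]
  exact MeasurableSet.iUnion fun y => (hY y).inter (hX _)

namespace IsPlay

variable (hp : IsPlay G nash D H δ T ℙ ℱ s a b ν)
include hp

lemma measurableSet_transition {t : ℕ} (ht : t < T) (y : S × A × B × S) :
    MeasurableSet[ℱ (t + 1)] {ω | (s t ω, a t ω, b t ω, s (t + 1) ω) = y} := by
  obtain ⟨y1, y2, y3, y4⟩ := y
  have : {ω | (s t ω, a t ω, b t ω, s (t + 1) ω) = (y1, y2, y3, y4)}
      = {ω | s t ω = y1} ∩ ({ω | a t ω = y2} ∩ ({ω | b t ω = y3} ∩ {ω | s (t + 1) ω = y4})) := by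
    ext ω; simp
  rw [this]
  exact (ℱ.mono t.le_succ _ (hp.measurable_s t ht.le y1)).inter ((hp.measurable_a t ht y2).inter
    ((hp.measurable_b t ht y3).inter (hp.measurable_s (t + 1) ht y4)))

/-- The state is a function of finitely many finite-valued variables, so every set `U` is allowed
and no σ-algebra on `DONQState` has to be chosen. -/
lemma measurableSet_randState {t : ℕ} (ht : t ≤ T) (U : Set (DONQState S A B)) :
    MeasurableSet[ℱ t] {ω | randState G nash D H δ T s a b t ω ∈ U} := by
  induction t generalizing U with
  | zero =>
    simp only [randState, state]
    exact MeasurableSet.const _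
  | succ t ih =>
    exact measurableSet_setOf_mem_comp
      (fun U => ℱ.mono t.le_succ _ (ih (Nat.le_of_succ_le ht) U))
      (hp.measurableSet_transition ht)
      (fun x y => step nash D H δ T x y.1 y.2.1 y.2.2.1 (G.r y.1 y.2.1 y.2.2.1) y.2.2.2) U

lemma measurable_along {t : ℕ} (ht : t < T) (f : DONQState S A B → S → A → B → S → ℝ) :
    Measurable[ℱ (t + 1)] (along G nash D H δ T s a b f t) := fun U _ =>
  measurableSet_setOf_mem_comp (fun U => ℱ.mono t.le_succ _ (hp.measurableSet_randState ht.le U))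
    (hp.measurableSet_transition ht) (fun x y => f x y.1 y.2.1 y.2.2.1 y.2.2.2) U

lemma measurable_comp {t : ℕ} (ht : t ≤ T) (f : DONQState S A B → S → ℝ) :
    Measurable[ℱ t] fun ω => f (randState G nash D H δ T s a b t ω) (s t ω) := fun U _ =>
  measurableSet_setOf_mem_comp (fun U => hp.measurableSet_randState ht U)
    (hp.measurable_s t ht) f U

/-- An exponential supermartingale: if each factor has conditional expectation at most one,
whatever the opponent does, then so has the product. -/
theorem integral_exp_sum_le_one [IsProbabilityMeasure ℙ]
    {g : ℕ → DONQState S A B → S → A → B → S → ℝ} {K : ℝ}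
    (hK : ∀ t < T, ∀ ω x y z,
      |g t (randState G nash D H δ T s a b t ω) (s t ω) x y z| ≤ K)
    (hg : ∀ t < T, ∀ ω y, ∑ x, (randState G nash D H δ T s a b t ω).pol (s t ω) x
      * ∑ z, G.P (s t ω) x y z
        * Real.exp (g t (randState G nash D H δ T s a b t ω) (s t ω) x y z) ≤ 1)
    {n : ℕ} (hn : n ≤ T) :
    Integrable (fun ω => Real.exp (∑ t ∈ Finset.range n, along G nash D H δ T s a b (g t) t ω)) ℙ ∧
    ∫ ω, Real.exp (∑ t ∈ Finset.range n, along G nash D H δ T s a b (g t) t ω) ∂ℙ ≤ 1 := by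
  have hmeas : ∀ n ≤ T, Measurable[ℱ n] fun ω =>
      Real.exp (∑ t ∈ Finset.range n, along G nash D H δ T s a b (g t) t ω) := fun n hn => by
    refine Real.measurable_exp.comp (Finset.measurable_fun_sum _ fun t ht => ?_)
    have ht := Finset.mem_range.1 ht
    exact (hp.measurable_along (by omega) (g t)).mono (ℱ.mono (by omega)) le_rfl
  have hbdd : ∀ n ≤ T, ∀ ω,
      Real.exp (∑ t ∈ Finset.range n, along G nash D H δ T s a b (g t) t ω)
        ≤ Real.exp (n * K) := fun n hn ω => by
    refine Real.exp_le_exp.2 ?_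
    calc _ ≤ ∑ _t ∈ Finset.range n, K := Finset.sum_le_sum fun t ht =>
          (le_abs_self _).trans (hK t (by have := Finset.mem_range.1 ht; omega) ω _ _ _)
      _ = n * K := by simp
  have hinteg : ∀ n ≤ T, Integrable (fun ω =>
      Real.exp (∑ t ∈ Finset.range n, along G nash D H δ T s a b (g t) t ω)) ℙ := fun n hn =>
    Integrable.of_bound ((hmeas n hn).mono (ℱ.le n) le_rfl).aestronglyMeasurable (Real.exp (n * K))
      (Eventually.of_forall fun ω => by
        rw [Real.norm_eq_abs, Real.abs_exp]; exact hbdd n hn ω)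
  refine ⟨hinteg n hn, ?_⟩
  induction n with
  | zero => simp
  | succ n ih =>
    have hnT : n < T := hn
    let X : Ω → DONQState S A B := randState G nash D H δ T s a b n
    let M : Ω → ℝ := fun ω =>
      Real.exp (∑ t ∈ Finset.range n, along G nash D H δ T s a b (g t) t ω)
    let F : A × B × S → Ω → ℝ := fun i ω =>
      M ω * Real.exp (g n (X ω) (s n ω) i.1 i.2.1 i.2.2)
    let E : A × B × S → Ω → ℝ := fun i =>
      Set.indicator {ω | a n ω = i.1 ∧ b n ω = i.2.1 ∧ s (n + 1) ω = i.2.2} fun _ => (1 : ℝ)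
    let law : A × B × S → Ω → ℝ := fun i ω =>
      (X ω).pol (s n ω) i.1 * ν n ω i.2.1 * G.P (s n ω) i.1 i.2.1 i.2.2
    have hFm : ∀ i, Measurable[ℱ n] (F i) := fun i =>
      (hmeas n hnT.le).mul (Real.measurable_exp.comp
        (hp.measurable_comp hnT.le fun x u => g n x u i.1 i.2.1 i.2.2))
    have hFb : ∀ i ω, ‖F i ω‖ ≤ Real.exp (n * K) * Real.exp K := fun i ω => by
      rw [norm_mul, Real.norm_eq_abs, Real.norm_eq_abs, Real.abs_exp, Real.abs_exp]
      exact mul_le_mul (hbdd n hnT.le ω) (Real.exp_le_exp.2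
        ((le_abs_self _).trans (hK n hnT ω _ _ _))) (Real.exp_pos _).le (Real.exp_pos _).le
    have hE : ∀ i : A × B × S, MeasurableSet {ω | a n ω = i.1 ∧ b n ω = i.2.1 ∧ s (n + 1) ω = i.2.2} :=
      fun i => ℱ.le (n + 1) _ ((hp.measurable_a n hnT i.1).inter
        ((hp.measurable_b n hnT i.2.1).inter (hp.measurable_s (n + 1) hn i.2.2)))
    have hEint : ∀ i, Integrable (E i) ℙ := fun i => (integrable_const 1).indicator (hE i)
    -- The new exponential factor depends on the outcome `i` of step `n`. Once `i` is fixed, `F i`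
    -- is `ℱ n`-measurable and bounded, so only the indicator `E i` is conditioned.
    have hpull : ∀ i, ℙ[fun ω => F i ω * E i ω | ℱ n] =ᵐ[ℙ] fun ω => F i ω * law i ω := fun i => by
      have h1 := condExp_stronglyMeasurable_mul_of_bound (μ := ℙ) (ℱ.le n)
        (hFm i).stronglyMeasurable (hEint i) _ (Eventually.of_forall (hFb i))
      filter_upwards [h1, hp.condLaw n hnT i.1 i.2.1 i.2.2] with ω h1 h2
      refine h1.trans ?_
      rw [Pi.mul_apply, h2]
      rfl
    have hFE : ∀ i, Integrable (fun ω => F i ω * E i ω) ℙ := fun i =>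
      (hEint i).bdd_mul ((hFm i).mono (ℱ.le n) le_rfl).aestronglyMeasurable
        (Eventually.of_forall (hFb i))
    have hdecomp : ∀ ω, Real.exp (∑ t ∈ Finset.range (n + 1),
        along G nash D H δ T s a b (g t) t ω) = ∑ i, F i ω * E i ω := fun ω => by
      rw [Finset.sum_eq_single (a n ω, b n ω, s (n + 1) ω)]
      · rw [Finset.sum_range_succ, Real.exp_add]
        simp [F, E, M, X, along]
      · rintro ⟨x, y, z⟩ - hne
        have : E (x, y, z) ω = 0 := Set.indicator_of_notMem (fun h => hne (by
          obtain ⟨h1, h2, h3⟩ := h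
          simp only at h1 h2 h3
          rw [h1, h2, h3])) _
        rw [this, mul_zero]
      · simp
    have hlaw : ∀ ω, ∑ i, F i ω * law i ω ≤ M ω := fun ω => by
      have hM : 0 ≤ M ω := (Real.exp_pos _).le
      -- With the opponent's average outermost, the hypothesis for each single action `y` suffices.
      have h1 : ∑ i, F i ω * law i ω = M ω * ∑ y, ν n ω y * ∑ x, (X ω).pol (s n ω) x
          * ∑ z, G.P (s n ω) x y z * Real.exp (g n (X ω) (s n ω) x y z) := by
        simp only [Fintype.sum_prod_type]
        rw [Finset.sum_comm]
        simp only [Finset.mul_sum]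
        refine Finset.sum_congr rfl fun y _ => Finset.sum_congr rfl fun x _ =>
          Finset.sum_congr rfl fun z _ => ?_
        simp only [F, law]
        ring
      rw [h1]
      exact mul_le_of_le_one_right hM (stdSimplex.sum_mul_le _ fun y => hg n hnT ω y)
    calc ∫ ω, Real.exp (∑ t ∈ Finset.range (n + 1), along G nash D H δ T s a b (g t) t ω) ∂ℙ
        = ∫ ω, ∑ i, F i ω * E i ω ∂ℙ := integral_congr_ae (Eventually.of_forall hdecomp)
      _ = ∑ i, ∫ ω, F i ω * E i ω ∂ℙ := integral_finsetSum _ fun i _ => hFE i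
      _ = ∑ i, ∫ ω, F i ω * law i ω ∂ℙ := Finset.sum_congr rfl fun i _ => by
          rw [← integral_condExp (ℱ.le n), integral_congr_ae (hpull i)]
      _ = ∫ ω, ∑ i, F i ω * law i ω ∂ℙ :=
          (integral_finsetSum _ fun i _ => integrable_condExp.congr (hpull i)).symm
      _ ≤ ∫ ω, M ω ∂ℙ := integral_mono
          (integrable_finsetSum _ fun i _ => integrable_condExp.congr (hpull i))
          (hinteg n hnT.le) hlaw
      _ ≤ 1 := ih hnT.le

/-- **Azuma–Hoeffding inequality** along a play, with variance proxies `v` that may depend on the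
transitions. -/
theorem measureReal_lt_sum_le [IsProbabilityMeasure ℙ]
    {f v : DONQState S A B → S → A → B → S → ℝ} {K c ε : ℝ}
    (hf : ∀ t < T, ∀ ω x y z, |f (randState G nash D H δ T s a b t ω) (s t ω) x y z| ≤ K)
    (hv : ∀ t < T, ∀ ω x y z, |v (randState G nash D H δ T s a b t ω) (s t ω) x y z| ≤ K)
    (hg : ∀ θ, 0 ≤ θ → ∀ t < T, ∀ ω y, ∑ x, (randState G nash D H δ T s a b t ω).pol (s t ω) x
      * ∑ z, G.P (s t ω) x y z
        * Real.exp (θ * f (randState G nash D H δ T s a b t ω) (s t ω) x y z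
          - θ ^ 2 / 2 * v (randState G nash D H δ T s a b t ω) (s t ω) x y z) ≤ 1)
    (hsum : ∀ ω, ∑ t ∈ Finset.range T, along G nash D H δ T s a b v t ω ≤ c)
    (hc : 0 < c) (hε : 0 ≤ ε) :
    ℙ.real {ω | ε < ∑ t ∈ Finset.range T, along G nash D H δ T s a b f t ω}
      ≤ Real.exp (-(ε ^ 2 / (2 * c))) := by
  -- This choice maximizes the exponent `θ * ε - θ ^ 2 / 2 * c`.
  set θ := ε / c with hθ
  have hθ0 : 0 ≤ θ := div_nonneg hε hc.le
  obtain ⟨hint, hle⟩ := hp.integral_exp_sum_le_one (n := T)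
    (g := fun _ X u x y z => θ * f X u x y z - θ ^ 2 / 2 * v X u x y z)
    (K := θ * K + θ ^ 2 / 2 * K) (fun t ht ω x y z => by
      refine (abs_sub _ _).trans (add_le_add ?_ ?_)
      · rw [abs_mul, abs_of_nonneg hθ0]
        exact mul_le_mul_of_nonneg_left (hf t ht ω x y z) hθ0
      · rw [abs_mul, abs_of_nonneg (by positivity : 0 ≤ θ ^ 2 / 2)]
        exact mul_le_mul_of_nonneg_left (hv t ht ω x y z) (by positivity))
    (hg θ hθ0) le_rfl
  set Y : Ω → ℝ := fun ω => Real.exp (∑ t ∈ Finset.range T, along G nash D H δ T s a b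
    (fun X u x y z => θ * f X u x y z - θ ^ 2 / 2 * v X u x y z) t ω) with hY
  have hmarkov := mul_meas_ge_le_integral_of_nonneg
    (Eventually.of_forall fun ω => (Real.exp_pos _).le : 0 ≤ᵐ[ℙ] Y) hint
    (Real.exp (ε ^ 2 / (2 * c)))
  have hsub : {ω | ε < ∑ t ∈ Finset.range T, along G nash D H δ T s a b f t ω}
      ⊆ {ω | Real.exp (ε ^ 2 / (2 * c)) ≤ Y ω} := by
    intro ω hω
    refine Real.exp_le_exp.2 ?_
    have h1 : ∑ t ∈ Finset.range T, along G nash D H δ T s a b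
        (fun X u x y z => θ * f X u x y z - θ ^ 2 / 2 * v X u x y z) t ω
        = θ * ∑ t ∈ Finset.range T, along G nash D H δ T s a b f t ω
          - θ ^ 2 / 2 * ∑ t ∈ Finset.range T, along G nash D H δ T s a b v t ω := by
      simp only [along, Finset.mul_sum, Finset.sum_sub_distrib]
    rw [h1]
    have h2 := mul_le_mul_of_nonneg_left (le_of_lt hω) hθ0
    have h3 := mul_le_mul_of_nonneg_left (hsum ω) (by positivity : 0 ≤ θ ^ 2 / 2)
    have h4 : ε ^ 2 / (2 * c) = θ * ε - θ ^ 2 / 2 * c := by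
      rw [hθ]; field_simp; ring
    linarith
  have h5 := measureReal_mono (μ := ℙ) hsub
  have h6 : Real.exp (ε ^ 2 / (2 * c)) * ℙ.real {ω | Real.exp (ε ^ 2 / (2 * c)) ≤ Y ω} ≤ 1 :=
    hmarkov.trans hle
  rw [Real.exp_neg, ← one_div, le_div_iff₀' (Real.exp_pos _)]
  exact (mul_le_mul_of_nonneg_left h5 (Real.exp_pos _).le).trans h6

end IsPlay

end Play

end DONQ

/-! ### The regret of DONQ-learning -/

namespace StochasticGame

variable {S A B : Type*} [Fintype S] {G : StochasticGame S A B}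

lemma abs_sub_nextValue_le {V : S → ℝ} {D : ℝ} (hV : ∀ z z', V z' - V z ≤ D)
    (u : S) (x : A) (y : B) (z : S) : |V z - G.nextValue V u x y| ≤ D := by
  rw [abs_le]
  constructor
  · linarith [nextValue_le (G := G) (V := V) (c := V z + D) (fun z' => by linarith [hV z z']) u x y]
  · linarith [le_nextValue (G := G) (V := V) (c := V z - D) (fun z' => by linarith [hV z' z]) u x y]

lemma sum_mul_exp_nextValue_le [Nonempty S] {V : S → ℝ} {D : ℝ} (hV : ∀ z z', V z' - V z ≤ D)
    (u : S) (x : A) (y : B) (θ : ℝ) :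
    ∑ z, G.P u x y z * Real.exp (θ * (V z - G.nextValue V u x y))
      ≤ Real.exp (θ ^ 2 * D ^ 2 / 8) := by
  obtain ⟨z₁, h₁⟩ := Finite.exists_max V
  obtain ⟨z₀, h₀⟩ := Finite.exists_min V
  refine (stdSimplex.sum_mul_exp_le (G.P u x y) (fun z => ⟨h₀ z, h₁ z⟩) θ).trans ?_
  have h2 : (V z₁ - V z₀) ^ 2 ≤ D ^ 2 :=
    pow_le_pow_left₀ (by linarith [h₀ z₁]) (hV z₀ z₁) 2
  gcongr

end StochasticGame

namespace DONQ

lemma weight_le_one {H : ℝ} (hH : 1 < H) (n i : ℕ) : weight H n i ≤ 1 := by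
  induction n with
  | zero => exact zero_le_one
  | succ n ih =>
    have h1 := one_sub_alpha_succ_nonneg hH n
    rw [weight]
    split_ifs
    · linarith
    · exact mul_le_one₀ (by linarith [alpha_nonneg hH (n + 1)]) (weight_nonneg hH n i) ih

/-! ### The three high-probability events -/

namespace IsPlay

variable {S A B : Type*} [Fintype S] [Fintype A] [Fintype B]
  [DecidableEq S] [DecidableEq A] [DecidableEq B] [Nonempty A]
  {G : StochasticGame S A B} {nash : (A → B → ℝ) → stdSimplex ℝ A × stdSimplex ℝ B}
  {D H δ : ℝ} {T : ℕ} {Ω : Type*} {m : MeasurableSpace Ω} {ℙ : Measure Ω} [IsProbabilityMeasure ℙ]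
  {ℱ : Filtration ℕ m} {s : ℕ → Ω → S} {a : ℕ → Ω → A} {b : ℕ → Ω → B}
  {ν : ℕ → Ω → stdSimplex ℝ B}

/-- One tail of the averaged noise at the triple `i` with sample size `n`. -/
lemma measureReal_beta_lt_noise_le [Nonempty S] (hp : IsPlay G nash D H δ T ℙ ℱ s a b ν) (hH : 1 < H)
    (hD : 0 < D) (hL : 0 ≤ Real.log (2 * T / δ)) {V : S → ℝ} (hV : ∀ z z', V z' - V z ≤ D)
    {σ : ℝ} (hσ : σ ^ 2 = 1) (i : S × A × B) {n : ℕ} (hn : 1 ≤ n) :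
    ℙ.real {ω | beta D H δ T n < ∑ t ∈ Finset.range T,
      if triples (fun t => s t ω) (fun t => a t ω) (fun t => b t ω) t = i then
        weight H n (visits (triples (fun t => s t ω) (fun t => a t ω) (fun t => b t ω)) (t + 1) i)
          * (σ * noise G V (fun t => s t ω) (fun t => a t ω) (fun t => b t ω) t) else 0}
      ≤ Real.exp (-(4 * Real.log (2 * T / δ))) := by
  have hpos : 0 < H := by linarith
  have hn' : (0 : ℝ) < n := by exact_mod_cast hn
  let f : DONQState S A B → S → A → B → S → ℝ := fun X u x y z =>
    if (u, x, y) = i then weight H n (X.N u x y + 1) * (σ * (V z - G.nextValue V u x y)) else 0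
  -- The proxy keeps the squared weight and the indicator of the triple, so its sum is of order `H /
  -- n` and does not grow with `T`.
  let v : DONQState S A B → S → A → B → S → ℝ := fun X u x y z =>
    if (u, x, y) = i then weight H n (X.N u x y + 1) ^ 2 * (D ^ 2 / 4) else 0
  have hσ1 : |σ| = 1 := (pow_eq_one_iff_of_nonneg (abs_nonneg σ) two_ne_zero).1 (by rw [sq_abs, hσ])
  have hN : ∀ ω t, triples (fun t => s t ω) (fun t => a t ω) (fun t => b t ω) t = i →
      (randState G nash D H δ T s a b t ω).N (s t ω) (a t ω) (b t ω) + 1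
        = visits (triples (fun t => s t ω) (fun t => a t ω) (fun t => b t ω)) (t + 1) i := by
    intro ω t h
    rw [← h, visits_succ_self, randState, state_N]
    rfl
  have hfsum : ∀ ω, ∑ t ∈ Finset.range T, along G nash D H δ T s a b f t ω
      = ∑ t ∈ Finset.range T,
        if triples (fun t => s t ω) (fun t => a t ω) (fun t => b t ω) t = i then
        weight H n (visits (triples (fun t => s t ω) (fun t => a t ω) (fun t => b t ω)) (t + 1) i)
          * (σ * noise G V (fun t => s t ω) (fun t => a t ω) (fun t => b t ω) t) else 0 := by
    intro ω
    refine Finset.sum_congr rfl fun t _ => ?_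
    by_cases h : triples (fun t => s t ω) (fun t => a t ω) (fun t => b t ω) t = i
    · rw [if_pos h, ← hN ω t h]
      exact if_pos h
    · rw [if_neg h]
      exact if_neg h
  have hvsum : ∀ ω, ∑ t ∈ Finset.range T, along G nash D H δ T s a b v t ω
      ≤ 2 * H / n * (D ^ 2 / 4) := by
    intro ω
    refine le_trans (le_of_eq ?_) (mul_le_mul_of_nonneg_right (sum_sq_weight_visits_le
      (k := triples (fun t => s t ω) (fun t => a t ω) (fun t => b t ω)) hH hn i T)
      (by positivity : 0 ≤ D ^ 2 / 4))
    rw [Finset.sum_mul]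
    refine Finset.sum_congr rfl fun t _ => ?_
    by_cases h : triples (fun t => s t ω) (fun t => a t ω) (fun t => b t ω) t = i
    · rw [if_pos h, ← hN ω t h]
      exact if_pos h
    · rw [if_neg h, zero_mul]
      exact if_neg h
  have hw : ∀ j, |weight H n j| ≤ 1 := fun j => by
    rw [abs_of_nonneg (weight_nonneg hH n j)]
    exact weight_le_one hH n j
  have key := hp.measureReal_lt_sum_le (f := f) (v := v) (K := D + D ^ 2)
    (c := 2 * H / n * (D ^ 2 / 4)) (ε := beta D H δ T n) (fun t _ ω x y z => ?_)
    (fun t _ ω x y z => ?_) (fun θ _ t _ ω y => ?_) hvsum (by positivity) (beta_nonneg hD.le n)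
  · simp only [hfsum] at key
    -- With `ε = beta` and `c = 2 * H / n * (D ^ 2 / 4)`, the exponent `ε ^ 2 / (2 * c)` is `4 * log
    -- (2 * T / δ)`.
    refine key.trans_eq ?_
    congr 2
    rw [beta, mul_pow, Real.sq_sqrt (by positivity)]
    field_simp
  · simp only [f]
    split_ifs
    · rw [abs_mul, abs_mul, hσ1, one_mul]
      exact (mul_le_mul (hw _) (StochasticGame.abs_sub_nextValue_le hV (s t ω) x y z)
        (abs_nonneg _) zero_le_one).trans (by nlinarith)
    · rw [abs_zero]; positivity
  · simp only [v]
    split_ifs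
    · rw [abs_mul, abs_pow, abs_of_nonneg (by positivity : 0 ≤ D ^ 2 / 4)]
      have h1 := mul_le_mul_of_nonneg_right (pow_le_one₀ (abs_nonneg _) (hw
        ((randState G nash D H δ T s a b t ω).N (s t ω) x y + 1)) (n := 2))
        (by positivity : 0 ≤ D ^ 2 / 4)
      exact h1.trans (by nlinarith [sq_nonneg D])
    · rw [abs_zero]; positivity
  · refine stdSimplex.sum_mul_le _ fun x => ?_
    simp only [f, v]
    split_ifs with h
    · set w := weight H n ((randState G nash D H δ T s a b t ω).N (s t ω) x y + 1)
      have h1 := StochasticGame.sum_mul_exp_nextValue_le (G := G) hV (s t ω) x y (θ * w * σ)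
      have h2 : ∀ z, Real.exp (θ * (w * (σ * (V z - G.nextValue V (s t ω) x y)))
          - θ ^ 2 / 2 * (w ^ 2 * (D ^ 2 / 4)))
          = Real.exp (θ * w * σ * (V z - G.nextValue V (s t ω) x y))
            * Real.exp (-((θ * w * σ) ^ 2 * D ^ 2 / 8)) := fun z => by
        rw [← Real.exp_add]
        congr 1
        rw [mul_pow (θ * w), hσ]
        ring
      simp only [h2]
      simp only [← mul_assoc]
      rw [← Finset.sum_mul]
      refine (mul_le_mul_of_nonneg_right h1 (Real.exp_pos _).le).trans_eq ?_
      rw [← Real.exp_add, add_neg_cancel, Real.exp_zero]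
    · simp

/-- With high probability, the averaged noise is dominated by the bonuses. -/
lemma measureReal_not_noiseBounded_le [Nonempty S] (hp : IsPlay G nash D H δ T ℙ ℱ s a b ν) (hH : 1 < H)
    (hD : 0 ≤ D) (hδ : 0 < δ) (hδ1 : δ < 1) {V : S → ℝ} (hV : ∀ z z', V z' - V z ≤ D)
    (hT : 1 ≤ T) (hcard : Fintype.card (S × A × B) ≤ T) :
    ℙ.real {ω | ¬ NoiseBounded G V D H δ T (fun t => s t ω) (fun t => a t ω) (fun t => b t ω)}
      ≤ δ := by
  have hT' : (1 : ℝ) ≤ T := by exact_mod_cast hT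
  have hL : 0 ≤ Real.log (2 * T / δ) := Real.log_nonneg (by
    rw [le_div_iff₀ hδ]; linarith)
  rcases hD.eq_or_lt with rfl | hD
  -- For `D = 0` the variance proxy degenerates, but then `V` is constant and there is no noise.
  · have hempty : {ω | ¬ NoiseBounded G V 0 H δ T (fun t => s t ω) (fun t => a t ω)
        (fun t => b t ω)} = ∅ := by
      refine Set.eq_empty_of_forall_notMem fun ω hω => hω fun i n _ _ => ?_
      have h0 : ∀ t, noise G V (fun t => s t ω) (fun t => a t ω) (fun t => b t ω) t = 0 :=
        fun t => abs_nonpos_iff.1 (StochasticGame.abs_sub_nextValue_le hV _ _ _ _)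
      simp [h0, beta]
    rw [hempty, measureReal_empty]
    exact hδ.le
  let bad : (S × A × B) × ℕ × ℝ → Set Ω := fun j => {ω | beta D H δ T j.2.1
    < ∑ t ∈ Finset.range T,
      if triples (fun t => s t ω) (fun t => a t ω) (fun t => b t ω) t = j.1 then
        weight H j.2.1 (visits (triples (fun t => s t ω) (fun t => a t ω) (fun t => b t ω))
          (t + 1) j.1) * (j.2.2 * noise G V (fun t => s t ω) (fun t => a t ω) (fun t => b t ω) t)
      else 0}
  let idx : Finset ((S × A × B) × ℕ × ℝ) := Finset.univ ×ˢ Finset.Icc 1 T ×ˢ {1, -1}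
  have hsub : {ω | ¬ NoiseBounded G V D H δ T (fun t => s t ω) (fun t => a t ω)
      (fun t => b t ω)} ⊆ ⋃ j ∈ idx, bad j := by
    intro ω hω
    simp only [NoiseBounded, Set.mem_ofPred_eq, not_forall, not_le, lt_abs] at hω
    obtain ⟨i, n, hn1, hnT, h | h⟩ := hω
    · refine Set.mem_biUnion (x := (i, n, 1)) (by simp [idx, hn1, hnT]) ?_
      simpa [bad] using h
    · refine Set.mem_biUnion (x := (i, n, -1)) (by simp [idx, hn1, hnT]) ?_
      rw [← Finset.sum_neg_distrib] at h
      simp only [bad, Set.mem_ofPred_eq]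
      refine h.trans_eq (Finset.sum_congr rfl fun t _ => ?_)
      split_ifs <;> simp
  have hbad : ∀ j ∈ idx, ℙ.real (bad j) ≤ Real.exp (-(4 * Real.log (2 * T / δ))) := by
    rintro ⟨i, n, σ⟩ hj
    simp only [idx, Finset.mem_product, Finset.mem_Icc, Finset.mem_insert, Finset.mem_singleton]
      at hj
    refine hp.measureReal_beta_lt_noise_le hH hD hL hV ?_ i hj.2.1.1
    rcases hj.2.2 with rfl | rfl <;> norm_num
  -- Triples, sample sizes and two signs; the number of triples is at most `T` by `hcard`.
  have hidx : (idx.card : ℝ) ≤ T * (T * 2) := by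
    have h1 : idx.card = Fintype.card (S × A × B) * (T * 2) := by
      have : ({1, -1} : Finset ℝ).card = 2 := Finset.card_pair (by norm_num)
      simp only [idx, Finset.card_product, Finset.card_univ, Nat.card_Icc, this]
      rfl
    rw [h1]
    push_cast
    gcongr
  have hexp : Real.exp (-(4 * Real.log (2 * T / δ))) = (δ / (2 * T)) ^ 4 := by
    have h1 : 0 < 2 * T / δ := by positivity
    have h2 : -(4 * Real.log (2 * T / δ)) = (4 : ℕ) * Real.log (δ / (2 * T)) := by
      rw [← inv_div, Real.log_inv]; push_cast; ring
    rw [h2, Real.exp_nat_mul, Real.exp_log (by positivity)]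
  calc ℙ.real {ω | ¬ NoiseBounded G V D H δ T (fun t => s t ω) (fun t => a t ω)
        (fun t => b t ω)}
      ≤ ℙ.real (⋃ j ∈ idx, bad j) := measureReal_mono hsub (measure_ne_top _ _)
    _ ≤ ∑ j ∈ idx, ℙ.real (bad j) := measureReal_biUnion_finset_le _ _
    _ ≤ ∑ _j ∈ idx, Real.exp (-(4 * Real.log (2 * T / δ))) := Finset.sum_le_sum hbad
    _ = idx.card * (δ / (2 * T)) ^ 4 := by rw [Finset.sum_const, nsmul_eq_mul, hexp]
    _ ≤ T * (T * 2) * (δ / (2 * T)) ^ 4 := by gcongr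
    _ = δ * (δ ^ 3 / (8 * T ^ 2)) := by field_simp; ring
    _ ≤ δ * 1 := by
        gcongr
        rw [div_le_one (by positivity)]
        have h1 : δ ^ 3 ≤ 1 := pow_le_one₀ hδ.le hδ1.le
        have h2 : (1 : ℝ) ≤ T ^ 2 := one_le_pow₀ hT'
        linarith
    _ = δ := mul_one δ

/-- With high probability, the actions of the learner lose little against its policy. -/
lemma measureReal_lt_sum_Vdown_sub_le [Nonempty B] (hp : IsPlay G nash D H δ T ℙ ℱ s a b ν)
    (hnash : IsNashSolver nash) (hH : 1 < H) (hD : 0 ≤ D) (hδ : 0 < δ) (hδ1 : δ < 1)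
    (hT : 1 ≤ T) :
    ℙ.real {ω | 2 * H * √(2 * T * Real.log (2 / δ)) < ∑ t ∈ Finset.range T,
      ((randState G nash D H δ T s a b t ω).Vdown (s t ω)
        - (randState G nash D H δ T s a b t ω).Qdown (s t ω) (a t ω) (b t ω))} ≤ δ := by
  have hT' : (0 : ℝ) < T := by exact_mod_cast hT
  have hpos : 0 < H := by linarith
  have hL : 0 ≤ Real.log (2 / δ) := Real.log_nonneg (by rw [le_div_iff₀ hδ]; linarith)
  have hreg : ∀ t ω, IsRegular H (randState G nash D H δ T s a b t ω) := fun t ω =>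
    isRegular_state hnash hD hH t
  refine (hp.measureReal_lt_sum_le
    (f := fun X u x y _ => X.Vdown u - X.Qdown u x y) (v := fun _ _ _ _ _ => H ^ 2 / 4)
    (K := H + H ^ 2) (c := T * (H ^ 2 / 4)) (fun t _ ω x y z => ?_) (fun t _ ω x y z => ?_)
    (fun θ hθ t _ ω y => ?_) (fun ω => ?_) (by positivity) (by positivity)).trans ?_
  · have h1 := (hreg t ω).Vdown_mem (s t ω)
    have h2 := (hreg t ω).Qdown_nonneg (s t ω) x y
    have h3 := (hreg t ω).Qdown_le (s t ω) x y
    rw [abs_le]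
    constructor <;> nlinarith [h1.1, h1.2]
  · rw [abs_of_nonneg (by positivity)]
    nlinarith
  · set X := randState G nash D H δ T s a b t ω with hX
    have h1 := stdSimplex.sum_mul_exp_le (X.pol (s t ω)) (f := fun x => X.Qdown (s t ω) x y)
      (fun x => ⟨(hreg t ω).Qdown_nonneg (s t ω) x y, (hreg t ω).Qdown_le (s t ω) x y⟩) (-θ)
    -- The policy's mean of column `y` is at least `Vdown`, so the increment is at most the downward
    -- deviation of `Qdown` from its mean; Hoeffding's lemma is therefore used with `-θ`.
    have h2 := (hreg t ω).Vdown_le_sum (s t ω) y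
    calc ∑ x, X.pol (s t ω) x * ∑ z, G.P (s t ω) x y z
          * Real.exp (θ * (X.Vdown (s t ω) - X.Qdown (s t ω) x y) - θ ^ 2 / 2 * (H ^ 2 / 4))
        = ∑ x, X.pol (s t ω) x
          * Real.exp (θ * (X.Vdown (s t ω) - X.Qdown (s t ω) x y) - θ ^ 2 / 2 * (H ^ 2 / 4)) := by
          simp only [← Finset.sum_mul, stdSimplex.sum_eq_one, one_mul]
      _ ≤ ∑ x, X.pol (s t ω) x * (Real.exp (-θ * (X.Qdown (s t ω) x y
            - ∑ x, X.pol (s t ω) x * X.Qdown (s t ω) x y)) * Real.exp (-(θ ^ 2 * H ^ 2 / 8))) := by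
          refine Finset.sum_le_sum fun x _ =>
            mul_le_mul_of_nonneg_left ?_ (stdSimplex.zero_le _ _)
          rw [← Real.exp_add]
          refine Real.exp_le_exp.2 ?_
          have := mul_le_mul_of_nonneg_left h2 hθ
          linarith
      _ ≤ Real.exp ((-θ) ^ 2 * (H - 0) ^ 2 / 8) * Real.exp (-(θ ^ 2 * H ^ 2 / 8)) := by
          simp only [← mul_assoc]
          rw [← Finset.sum_mul]
          exact mul_le_mul_of_nonneg_right h1 (Real.exp_pos _).le
      _ = 1 := by
          rw [← Real.exp_add, sub_zero, neg_sq, add_neg_cancel, Real.exp_zero]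
  · simp [along]
  · have h1 : (2 * H * √(2 * T * Real.log (2 / δ))) ^ 2 / (2 * (T * (H ^ 2 / 4)))
        = 16 * Real.log (2 / δ) := by
      rw [mul_pow, Real.sq_sqrt (by positivity)]
      field_simp
      ring
    rw [h1]
    have h2 : -(16 * Real.log (2 / δ)) ≤ Real.log (δ / 2) := by
      have : Real.log (δ / 2) = -Real.log (2 / δ) := by rw [← Real.log_inv, inv_div]
      linarith
    refine (Real.exp_le_exp.2 h2).trans ?_
    rw [Real.exp_log (by positivity)]
    linarith

/-- With high probability, the sum of the noise is not too negative. -/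
lemma measureReal_lt_sum_neg_noise_le [Nonempty S] (hp : IsPlay G nash D H δ T ℙ ℱ s a b ν)
    (hD : 0 ≤ D) (hδ : 0 < δ) (hδ1 : δ < 1) (hT : 1 ≤ T) {V : S → ℝ}
    (hV : ∀ z z', V z' - V z ≤ D) :
    ℙ.real {ω | D * √(T * Real.log (4 / δ)) < ∑ t ∈ Finset.range T,
      -noise G V (fun t => s t ω) (fun t => a t ω) (fun t => b t ω) t} ≤ δ := by
  have hT' : (0 : ℝ) < T := by exact_mod_cast hT
  have hL : 0 ≤ Real.log (4 / δ) := Real.log_nonneg (by rw [le_div_iff₀ hδ]; linarith)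
  rcases hD.eq_or_lt with rfl | hD
  · have h0 : ∀ ω t, noise G V (fun t => s t ω) (fun t => a t ω) (fun t => b t ω) t = 0 :=
      fun ω t => abs_nonpos_iff.1 (StochasticGame.abs_sub_nextValue_le hV _ _ _ _)
    simp [h0, hδ.le]
  refine (hp.measureReal_lt_sum_le
    (f := fun _ u x y z => -(V z - G.nextValue V u x y)) (v := fun _ _ _ _ _ => D ^ 2 / 4)
    (K := D + D ^ 2) (c := T * (D ^ 2 / 4)) (fun t _ ω x y z => ?_) (fun t _ ω x y z => ?_)
    (fun θ hθ t _ ω y => ?_) (fun ω => ?_) (by positivity) (by positivity)).trans ?_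
  · rw [abs_neg]
    exact (StochasticGame.abs_sub_nextValue_le hV _ _ _ _).trans (by nlinarith)
  · rw [abs_of_nonneg (by positivity)]
    nlinarith
  · refine stdSimplex.sum_mul_le _ fun x => ?_
    have h1 := StochasticGame.sum_mul_exp_nextValue_le (G := G) hV (s t ω) x y (-θ)
    have h2 : ∀ z, Real.exp (θ * -(V z - G.nextValue V (s t ω) x y) - θ ^ 2 / 2 * (D ^ 2 / 4))
        = Real.exp (-θ * (V z - G.nextValue V (s t ω) x y))
          * Real.exp (-((-θ) ^ 2 * D ^ 2 / 8)) := fun z => by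
      rw [← Real.exp_add]
      congr 1
      ring
    simp only [h2, ← mul_assoc]
    rw [← Finset.sum_mul]
    refine (mul_le_mul_of_nonneg_right h1 (Real.exp_pos _).le).trans_eq ?_
    rw [← Real.exp_add, add_neg_cancel, Real.exp_zero]
  · simp [along]
  · have h1 : (D * √(T * Real.log (4 / δ))) ^ 2 / (2 * (T * (D ^ 2 / 4)))
        = 2 * Real.log (4 / δ) := by
      rw [mul_pow, Real.sq_sqrt (by positivity)]
      field_simp
      ring
    rw [h1]
    have h2 : -(2 * Real.log (4 / δ)) ≤ Real.log (δ / 4) := by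
      have : Real.log (δ / 4) = -Real.log (4 / δ) := by rw [← Real.log_inv, inv_div]
      linarith
    refine (Real.exp_le_exp.2 h2).trans ?_
    rw [Real.exp_log (by positivity)]
    linarith

end IsPlay

end DONQ

/-! ### The theorem: a union bound over the three exceptional events -/

theorem theorem1 :
    ∃ C : ℝ, ∀ (S A B : Type*) [Fintype S] [Fintype A] [Fintype B]
      [DecidableEq S] [DecidableEq A] [DecidableEq B] [Nonempty S] [Nonempty A] [Nonempty B]
      (G : StochasticGame S A B), G.Communicating →
      ∀ D : ℝ≥0, G.diameter ≤ (D : ℝ≥0∞) →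
      ∃ Jstar : ℝ, G.IsGameValue Jstar ∧
        ∀ (nash : (A → B → ℝ) → stdSimplex ℝ A × stdSimplex ℝ B), IsNashSolver nash →
        ∀ (H : ℝ), 1 < H → ∀ (δ : ℝ), 0 < δ → δ < 1 → ∀ (T : ℕ),
        ∀ (Ω : Type*) (m : MeasurableSpace Ω) (ℙ : Measure Ω) [IsProbabilityMeasure ℙ]
          (ℱ : Filtration ℕ m) (s : ℕ → Ω → S) (a : ℕ → Ω → A) (b : ℕ → Ω → B)
          (ν : ℕ → Ω → stdSimplex ℝ B),
          DONQ.IsPlay G nash D H δ T ℙ ℱ s a b ν →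
          1 - 3 * δ ≤ ℙ.real {ω |
            regret G Jstar T (fun t => s t ω) (fun t => a t ω) (fun t => b t ω) ≤
              D * T / H
              + 2 * H * Real.sqrt (2 * T * Real.log (2 / δ))
              + 12 * D * Real.sqrt (Fintype.card S * Fintype.card A * Fintype.card B * H * T
                  * Real.log (2 * T / δ))
              + C * (Fintype.card S * Fintype.card A * Fintype.card B * H
                  + D * Real.sqrt (T * Real.log (4 / δ)))} := by
  -- The constant 2 is the one in front of `S A B H` in `regret_le_of_noiseBounded`; the noise sum
  -- needs only 1.
  refine ⟨2, fun S A B _ _ _ _ _ _ _ _ _ G _ D hD => ?_⟩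
  obtain ⟨J, hJ, hJ1, hJV⟩ := StochasticGame.exists_isGameValue hD
  refine ⟨J, hJ, fun nash hnash H hH δ hδ hδ1 T Ω m ℙ _ ℱ s a b ν hp => ?_⟩
  have hpos : 0 < H := by linarith
  have hD0 : (0 : ℝ) ≤ D := D.coe_nonneg
  -- If there are more triples than steps, the regret is at most `T ≤ S A B H` surely, because `J ≤
  -- 1`. Otherwise the union bound over triples is affordable.
  rcases lt_or_ge T (Fintype.card (S × A × B)) with hcard | hcard
  · have huniv : {ω | regret G J T (fun t => s t ω) (fun t => a t ω) (fun t => b t ω) ≤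
        D * T / H + 2 * H * √(2 * T * Real.log (2 / δ))
        + 12 * D * √(Fintype.card S * Fintype.card A * Fintype.card B * H * T
          * Real.log (2 * T / δ))
        + 2 * (Fintype.card S * Fintype.card A * Fintype.card B * H
          + D * √(T * Real.log (4 / δ)))} = Set.univ := by
      refine Set.eq_univ_of_forall fun ω => ?_
      have h1 : regret G J T (fun t => s t ω) (fun t => a t ω) (fun t => b t ω) ≤ T := by
        refine (Finset.sum_le_card_nsmul _ _ 1 fun t _ => ?_).trans_eq (by simp)
        linarith [(G.r_mem (s t ω) (a t ω) (b t ω)).1]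
      have h2 : (T : ℝ) ≤ Fintype.card S * Fintype.card A * Fintype.card B := by
        have : (T : ℝ) ≤ Fintype.card (S × A × B) := by exact_mod_cast hcard.le
        simpa only [Fintype.card_prod, Nat.cast_mul, mul_assoc] using this
      have h3 : (Fintype.card S * Fintype.card A * Fintype.card B : ℝ)
          ≤ Fintype.card S * Fintype.card A * Fintype.card B * H :=
        le_mul_of_one_le_right (by positivity) hH.le
      have h4 : (0 : ℝ) ≤ D * T / H := by positivity
      have h5 : 0 ≤ 2 * H * √(2 * T * Real.log (2 / δ)) := by positivity
      have h6 : 0 ≤ 12 * D * √(Fintype.card S * Fintype.card A * Fintype.card B * H * T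
        * Real.log (2 * T / δ)) := by positivity
      have h7 : 0 ≤ D * √(T * Real.log (4 / δ)) := by positivity
      simp only [Set.mem_ofPred_eq]
      linarith
    rw [huniv, probReal_univ]
    linarith
  · have hT : 1 ≤ T := Fintype.card_pos.trans_le hcard
    obtain ⟨V, hV⟩ := StochasticGame.exists_isDiscountedValue (G := G) hH
    have hspan : ∀ z z', V z' - V z ≤ D := fun z z' => hV.sub_le_diameter hH hD z z'
    have e1 := hp.measureReal_not_noiseBounded_le hH hD0 hδ hδ1 hspan hT hcard
    have e2 := hp.measureReal_lt_sum_Vdown_sub_le hnash hH hD0 hδ hδ1 hT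
    have e3 := hp.measureReal_lt_sum_neg_noise_le hD0 hδ hδ1 hT hspan
    set E1 := {ω | ¬ DONQ.NoiseBounded G V D H δ T (fun t => s t ω) (fun t => a t ω)
      (fun t => b t ω)}
    set E2 := {ω | 2 * H * √(2 * T * Real.log (2 / δ)) < ∑ t ∈ Finset.range T,
      ((DONQ.randState G nash D H δ T s a b t ω).Vdown (s t ω)
        - (DONQ.randState G nash D H δ T s a b t ω).Qdown (s t ω) (a t ω) (b t ω))}
    set E3 := {ω | D * √(T * Real.log (4 / δ)) < ∑ t ∈ Finset.range T,
      -DONQ.noise G V (fun t => s t ω) (fun t => a t ω) (fun t => b t ω) t}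
    have hcover : (Set.univ : Set Ω) ⊆ {ω |
        regret G J T (fun t => s t ω) (fun t => a t ω) (fun t => b t ω) ≤
          D * T / H + 2 * H * √(2 * T * Real.log (2 / δ))
          + 12 * D * √(Fintype.card S * Fintype.card A * Fintype.card B * H * T
            * Real.log (2 * T / δ))
          + 2 * (Fintype.card S * Fintype.card A * Fintype.card B * H
            + D * √(T * Real.log (4 / δ)))} ∪ (E1 ∪ (E2 ∪ E3)) := by
      intro ω _
      by_contra hω
      simp only [Set.mem_union, not_or] at hω
      obtain ⟨h0, h1, h2, h3⟩ := hω
      refine h0 ?_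
      simp only [E1, Set.mem_ofPred_eq, not_not] at h1
      simp only [E2, Set.mem_ofPred_eq, not_lt, DONQ.randState] at h2
      simp only [E3, Set.mem_ofPred_eq, not_lt] at h3
      have hreg := DONQ.regret_le_of_noiseBounded (nash := nash) hnash hD0 hH hV
        (hJV H hH V hV) h1
      have h7 : 0 ≤ D * √(T * Real.log (4 / δ)) := by positivity
      simp only [Set.mem_ofPred_eq]
      linarith
    have htot := (measureReal_mono (μ := ℙ) hcover).trans (measureReal_union_le _ _)
    rw [probReal_univ] at htot
    have h12 := measureReal_union_le (μ := ℙ) E1 (E2 ∪ E3)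
    have h23 := measureReal_union_le (μ := ℙ) E2 E3
    linarith
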